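/- **Setting.** Let $\mathcal S,\mathcal A$ be finite sets with $S=|\mathcal S|\ge 1$ and $A=|\mathcal A|\ge 2$, let $H\ge 1$, $\gamma\in(0,1]$, $\varepsilon>0$, $\delta\in(0,1)$, and $s_1\in\mathcal S$. Consider an episodic MDP with transition probabilities $p_h(\cdot\mid s,a)$ and a known deterministic reward function $r_h(s,a)\in[0,1]$, $h\in[H]=\{1,\dots,H\}$. A policy is a family of maps $\pi_h:\mathcal S\to\mathcal A$, $h\in[H]$. Its value is $V_1^\pi(s_1)=\mathbb E^\pi\big[\sum_{h=1}^H\gamma^{h-1}r_h(s_h,a_h)\big]$, where $a_h=\pi_h(s_h)$ and $s_{h+1}\sim p_h(\cdot\mid s_h,a_h)$, and $V_1^\star(s_1)=\max_\pi V_1^\pi(s_1)$. Put $\sigma_h=\sum_{i=0}^{h-1}\gamma^i$. **Confidence bounds.** After $t$ episodes let $n_h^t(s,a)$ and $n_h^t(s,a,s')$ be the numbers of episodes $i\le t$ with $(s_h^i,a_h^i)=(s,a)$, respectively $(s_h^i,a_h^i,s_{h+1}^i)=(s,a,s')$. Let $\hat p_h^t(s'\mid s,a)=n_h^t(s,a,s')/n_h^t(s,a)$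 if $n_h^t(s,a)>0$ and $1/S$ otherwise. With $$\beta(n,\delta)=\log\frac{2SAH}{\delta}+(S-1)\log\Big(e\Big(1+\frac n{S-1}\Big)\Big)$$ let $$\mathcal C_h^t(s,a)=\Big\{q \text{ a probability vector on }\mathcal S:\ \mathrm{KL}\big(\hat p_h^t(\cdot\mid s,a),q\big)\le \frac{\beta(n_h^t(s,a),\delta)}{n_h^t(s,a)}\Big\},$$ where $1/0=+\infty$ and $\mathrm{KL}(p,q)=\sum_s p(s)\log\frac{p(s)}{q(s)}$, which is $+\infty$ unless $p\ll q$. Put $\overline V_{H+1}^t=\underline V_{H+1}^t=0$ and, for $h=H,\dots,1$, $$\overline Q_h^t(s,a)=r_h(s,a)+\gamma\max_{q\in\mathcal C_h^t(s,a)}\sum_{s'}q(s')\overline V_{h+1}^t(s'),\qquad \overline V_h^t(s)=\max_a\overline Q_h^t(s,a),$$ $$\underline Q_h^t(s,a)=r_h(s,a)+\gamma\min_{q\in\mathcal C_h^t(s,a)}\sum_{s'}q(s')\underline V_{h+1}^t(s'),\qquad \underline V_h^t(s)=\max_a\underline Q_h^t(s,a).$$ **BPI-UCRL.** For every $t\ge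 0$, episode $t+1$ is played from $s_1$ with a policy $\pi^{t+1}$ that is greedy for $\overline Q^t$. The stopping time is $\tau=\inf\{t\in\mathbb N:\overline V_1^t(s_1)-\underline V_1^t(s_1)\le\varepsilon\}$, where $t=0$ is allowed. The recommended policy $\hat\pi_\tau$ is greedy for $\underline Q^\tau$. Ties are broken arbitrarily, as a function of the data collected so far. **Theorem.** BPI-UCRL with this threshold $\beta$ is $(\varepsilon,\delta)$-correct for best-policy identification: for all transition probabilities, $$\mathbb P\big(\tau<\infty\ \text{ and }\ V_1^\star(s_1)-V_1^{\hat\pi_\tau}(s_1)\le\varepsilon\big)\ge 1-\delta .$$ Moreover, with probability at least $1-\delta$, one has $\tau\le\max(0,B)$ where $$B=\frac{\mathcal C_HSA}{\varepsilon^2}\left[\log\frac{2SAH}{\delta}+2(S-1)\log\left(\frac{\mathcal C_HSA}{\varepsilon^2}\left(\log\frac{2SAH}{\delta}+(S-1)\Big(\sqrt e+\sqrt{\tfrac e{S-1}}\Big)\right)\right)+(S-1)\right]$$ and $\mathcal C_H=64(1+\sqrt2)^2\sigma_H^4$. For $S=1$ all terms with a factor $S-1$ are read as $0$. If $\varepsilon\le\sigma_H$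 then $B\ge 0$, so that the bound is $\tau\le B$. -/

import Mathlib

namespace BPI

noncomputable section

/-- A deterministic, step-dependent policy. Steps are numbered `0, …, H - 1`. -/
abbrev Policy (S A : Type*) (H : ℕ) := Fin H → S → A

/-- An episode: the visited states (including the state reached after the last action) and the
actions played. -/
abbrev Episode (S A : Type*) (H : ℕ) := (Fin (H + 1) → S) × (Fin H → A)

/-- The data collected in the first `t` episodes. -/
abbrev History (S A : Type*) (H t : ℕ) := Fin t → Episode S A H

section MDP

variable {S A : Type*} [Fintype S] [Fintype A] [DecidableEq S] [DecidableEq A] {H : ℕ}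

/-- The probability of the episode `z` when the policy `π` is played from the initial state `s₁`
in the MDP with transition probabilities `p h s a s'`. -/
def episodeProb (p : Fin H → S → A → S → ℝ) (π : Policy S A H) (s₁ : S)
    (z : Episode S A H) : ℝ :=
  (if z.1 0 = s₁ then 1 else 0) *
    ∏ h : Fin H, (if z.2 h = π h (z.1 h.castSucc) then 1 else 0) *
      p h (z.1 h.castSucc) (z.2 h) (z.1 h.succ)

/-- The discounted sum of rewards along an episode. -/
def episodeReturn (γ : ℝ) (r : Fin H → S → A → ℝ) (z : Episode S A H) : ℝ :=
  ∑ h : Fin H, γ ^ (h : ℕ) * r h (z.1 h.castSucc) (z.2 h)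

/-- The value of `π` in the first step, from state `s₁`: the expected discounted return. -/
def value (γ : ℝ) (r : Fin H → S → A → ℝ) (p : Fin H → S → A → S → ℝ) (π : Policy S A H)
    (s₁ : S) : ℝ :=
  ∑ z : Episode S A H, episodeProb p π s₁ z * episodeReturn γ r z

/-- The optimal value in the first step: the maximum over the finitely many policies. -/
def optValue (γ : ℝ) (r : Fin H → S → A → ℝ) (p : Fin H → S → A → S → ℝ) (s₁ : S) : ℝ :=
  ⨆ π : Policy S A H, value γ r p π s₁

/-! ### Counts, empirical transitions and confidence regions -/

/-- Number of visits of `(s, a)` in step `h`. -/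
def count {t : ℕ} (D : History S A H t) (h : Fin H) (s : S) (a : A) : ℕ :=
  (Finset.univ.filter fun i : Fin t => (D i).1 h.castSucc = s ∧ (D i).2 h = a).card

/-- Number of transitions from `(s, a)` to `s'` in step `h`. -/
def countNext {t : ℕ} (D : History S A H t) (h : Fin H) (s : S) (a : A) (s' : S) : ℕ :=
  (Finset.univ.filter fun i : Fin t =>
    (D i).1 h.castSucc = s ∧ (D i).2 h = a ∧ (D i).1 h.succ = s').card

/-- Empirical transition probabilities, uniform for unvisited pairs. -/
def empirical {t : ℕ} (D : History S A H t) (h : Fin H) (s : S) (a : A) (s' : S) : ℝ :=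
  if count D h s a = 0 then 1 / (Fintype.card S : ℝ)
  else (countNext D h s a s' : ℝ) / (count D h s a : ℝ)

/-- Kullback–Leibler divergence of two probability vectors; it is `⊤` unless `p` is absolutely
continuous with respect to `q`. -/
def kl (p q : S → ℝ) : EReal :=
  open Classical in
  if ∀ s, q s = 0 → p s = 0 then ((∑ s, p s * Real.log (p s / q s) : ℝ) : EReal) else ⊤

/-- The threshold
`β(n, δ) = log (2 S A H / δ) + (S - 1) log (e (1 + n / (S - 1)))`, where `nS`, `nA` are the numbers
of states and actions. For `nS = 1` the second summand is `0`. -/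
def threshold (nS nA H : ℕ) (δ : ℝ) (n : ℝ) : ℝ :=
  Real.log (2 * nS * nA * H / δ) +
    ((nS : ℝ) - 1) * Real.log (Real.exp 1 * (1 + n / ((nS : ℝ) - 1)))

/-- The confidence radius `β(n, δ) / n`, with the convention `1 / 0 = +∞`. -/
def radius (nS nA H : ℕ) (δ : ℝ) (n : ℕ) : EReal :=
  if n = 0 then ⊤ else ((threshold nS nA H δ n / n : ℝ) : EReal)

/-- The confidence region for the transition probabilities from `(s, a)` in step `h`. -/
def confRegion (δ : ℝ) {t : ℕ} (D : History S A H t) (h : Fin H) (s : S) (a : A) :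
    Set (S → ℝ) :=
  {q | q ∈ stdSimplex ℝ S ∧
    kl (empirical D h s a) q ≤ radius (Fintype.card S) (Fintype.card A) H δ (count D h s a)}

/-! ### Confidence bounds on the optimal value functions -/

/-- `r_h(s, a) + γ max_{q ∈ C_h(s, a)} ∑ s', q(s') W(s')`. -/
def upperBackup (γ δ : ℝ) (r : Fin H → S → A → ℝ) {t : ℕ} (D : History S A H t)
    (h : Fin H) (W : S → ℝ) (s : S) (a : A) : ℝ :=
  r h s a + γ * sSup ((fun q : S → ℝ => ∑ s', q s' * W s') '' confRegion δ D h s a)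

/-- `r_h(s, a) + γ min_{q ∈ C_h(s, a)} ∑ s', q(s') W(s')`. -/
def lowerBackup (γ δ : ℝ) (r : Fin H → S → A → ℝ) {t : ℕ} (D : History S A H t)
    (h : Fin H) (W : S → ℝ) (s : S) (a : A) : ℝ :=
  r h s a + γ * sInf ((fun q : S → ℝ => ∑ s', q s' * W s') '' confRegion δ D h s a)

/-- Upper confidence bound on the optimal value function, by backward induction from
`0` after the last step. -/
def upperV (γ δ : ℝ) (r : Fin H → S → A → ℝ) {t : ℕ} (D : History S A H t) :
    Fin (H + 1) → S → ℝ :=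
  Fin.reverseInduction (motive := fun _ => S → ℝ) (fun _ => 0)
    (fun h W s => ⨆ a, upperBackup γ δ r D h W s a)

/-- Lower confidence bound on the optimal value function. -/
def lowerV (γ δ : ℝ) (r : Fin H → S → A → ℝ) {t : ℕ} (D : History S A H t) :
    Fin (H + 1) → S → ℝ :=
  Fin.reverseInduction (motive := fun _ => S → ℝ) (fun _ => 0)
    (fun h W s => ⨆ a, lowerBackup γ δ r D h W s a)

/-- Upper confidence bound on the optimal Q-value function. -/
def upperQ (γ δ : ℝ) (r : Fin H → S → A → ℝ) {t : ℕ} (D : History S A H t)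
    (h : Fin H) (s : S) (a : A) : ℝ :=
  upperBackup γ δ r D h (upperV γ δ r D h.succ) s a

/-- Lower confidence bound on the optimal Q-value function. -/
def lowerQ (γ δ : ℝ) (r : Fin H → S → A → ℝ) {t : ℕ} (D : History S A H t)
    (h : Fin H) (s : S) (a : A) : ℝ :=
  lowerBackup γ δ r D h (lowerV γ δ r D h.succ) s a

end MDP

/-! ### Algorithms for best-policy identification -/

/-- `policy t D` is played in the episode that follows the data `D` of the first `t` episodes,
`halts t D` says whether the stopping condition holds after these data, and `recommend t D` is the
policy that is returned if the algorithm stops there. -/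
structure Algorithm (S A : Type*) (H : ℕ) where
  policy : (t : ℕ) → History S A H t → Policy S A H
  halts : (t : ℕ) → History S A H t → Prop
  recommend : (t : ℕ) → History S A H t → Policy S A H

/-- `π` is greedy for `Q`. -/
def IsGreedy {S A : Type*} {H : ℕ} (Q : Fin H → S → A → ℝ) (π : Policy S A H) : Prop :=
  ∀ h s a, Q h s a ≤ Q h s (π h s)

section Run

variable {S A : Type*} [Fintype S] [Fintype A] [DecidableEq S] [DecidableEq A] {H : ℕ}

/-- `alg` is BPI-UCRL for the reward function `r`, with an arbitrary rule for breaking ties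
in the two argmax. -/
structure IsBPIUCRL (alg : Algorithm S A H) (γ ε δ : ℝ) (r : Fin H → S → A → ℝ) (s₁ : S) :
    Prop where
  greedy_upper : ∀ t (D : History S A H t), IsGreedy (upperQ γ δ r D) (alg.policy t D)
  halts_iff : ∀ t (D : History S A H t),
    alg.halts t D ↔ upperV γ δ r D 0 s₁ - lowerV γ δ r D 0 s₁ ≤ ε
  greedy_lower : ∀ t (D : History S A H t), IsGreedy (lowerQ γ δ r D) (alg.recommend t D)

/-- The data of the first `t` episodes of the sequence `Z`. -/
def historyOf {Ω : Type*} (Z : ℕ → Ω → Episode S A H) (t : ℕ) (ω : Ω) : History S A H t :=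
  fun i => Z i ω

/-- The random episodes `Z 0, Z 1, …` are generated by `alg` in the MDP with transitions `p` and
initial state `s₁`: given the first `i` episodes, episode `i` is distributed as an episode of the
policy that `alg` selects from them. -/
structure IsRun {Ω : Type*} [MeasurableSpace Ω] (μ : MeasureTheory.Measure Ω)
    (alg : Algorithm S A H) (p : Fin H → S → A → S → ℝ) (s₁ : S)
    (Z : ℕ → Ω → Episode S A H) : Prop where
  measurable : ∀ t z, MeasurableSet {ω | Z t ω = z}
  law : ∀ (t : ℕ) (z : ℕ → Episode S A H),
    μ.real {ω | ∀ i < t, Z i ω = z i} =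
      ∏ i ∈ Finset.range t,
        episodeProb p (alg.policy i fun j : Fin i => z j) s₁ (z i)

/-- The stopping time: the first `t ≥ 0` at which the stopping condition holds, `⊤` if there is
none. -/
def stoppingTime {Ω : Type*} (alg : Algorithm S A H) (Z : ℕ → Ω → Episode S A H) (ω : Ω) : ℕ∞ :=
  sInf ((fun t : ℕ => (t : ℕ∞)) '' {t | alg.halts t (historyOf Z t ω)})

/-- The algorithm stops and the policy that it returns is `ε`-optimal. -/
def Succeeds {Ω : Type*} (alg : Algorithm S A H) (γ ε : ℝ) (r : Fin H → S → A → ℝ)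
    (p : Fin H → S → A → S → ℝ) (s₁ : S) (Z : ℕ → Ω → Episode S A H) (ω : Ω) : Prop :=
  ∃ t : ℕ, stoppingTime alg Z ω = t ∧
    optValue γ r p s₁ - value γ r p (alg.recommend t (historyOf Z t ω)) s₁ ≤ ε

end Run

/-- `σ_h = ∑_{i < h} γ ^ i`. -/
def sigma (γ : ℝ) (h : ℕ) : ℝ := ∑ i ∈ Finset.range h, γ ^ i

/-- `C_H = 64 (1 + √2)² σ_H⁴`. -/
def constC (γ : ℝ) (H : ℕ) : ℝ := 64 * (1 + √2) ^ 2 * sigma γ H ^ 4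

/-- The bound on the stopping time. For `nS = 1` all terms with a factor `nS - 1` are `0`. -/
def sampleBound (nS nA H : ℕ) (γ ε δ : ℝ) : ℝ :=
  constC γ H * nS * nA / ε ^ 2 *
    (Real.log (2 * nS * nA * H / δ) +
      2 * ((nS : ℝ) - 1) *
        Real.log (constC γ H * nS * nA / ε ^ 2 *
          (Real.log (2 * nS * nA * H / δ) +
            ((nS : ℝ) - 1) * (√(Real.exp 1) + √(Real.exp 1 / ((nS : ℝ) - 1))))) +
      ((nS : ℝ) - 1))

end

end BPI

/-!
For each `(h, s, a)`, the likelihood ratio of the uniform Dirichlet mixture `∫ ∏ q(s') ^ n(s') dq`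
against the true transition law is a nonnegative supermartingale, so that Ville's inequality keeps
`p_h(⋅ | s, a)` in all confidence regions at once, up to probability `δ / 2`. Likewise
`exp (N / 2 - n)`, where `N` is the sum of the conditional visit probabilities and `n` the visit
count, is a supermartingale, and `n ≥ N / 2 - log (2SAH / δ)` fails with probability at most
`δ / 2`.

On this event, backward induction gives `V⋆ ≤ V̄` and `V̲ ≤ V^π̂`, hence correctness, and bounds
`V̄ - V̲` by the value of the played policy for the reward `4 σ_H min(1, √(β / n))`. Summing over
the episodes before `τ`, `∑ x_t / √(max 1 (x_0 + ⋯ + x_{t-1})) ≤ (1 + √2) √(∑ x_t)` and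
Cauchy–Schwarz yield `τ ε² ≤ C_H S A β(τ)`; a first crude bound `log x ≤ √x` turns this into an
explicit one.
-/

namespace BPI

noncomputable section

open MeasureTheory

section Episodes

variable {S A : Type*} {H : ℕ}

/-- The episode that plays `a` in state `s` and then continues with the episode `z`. -/
def Episode.cons (s : S) (a : A) (z : Episode S A H) : Episode S A (H + 1) :=
  (Fin.cons s z.1, Fin.cons a z.2)

/-- Splitting an episode into its first state, its first action and the remaining episode. -/
def Episode.consEquiv : S × A × Episode S A H ≃ Episode S A (H + 1) where
  toFun x := Episode.cons x.1 x.2.1 x.2.2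
  invFun z := (z.1 0, z.2 0, Fin.tail z.1, Fin.tail z.2)
  left_inv _ := by simp [Episode.cons]
  right_inv _ := by simp [Episode.cons]

lemma episodeReturn_cons (γ : ℝ) (r : Fin (H + 1) → S → A → ℝ) (s : S) (a : A)
    (z : Episode S A H) :
    episodeReturn γ r (Episode.cons s a z) = r 0 s a + γ * episodeReturn γ (Fin.tail r) z := by
  simp [episodeReturn, Episode.cons, Fin.tail, Fin.sum_univ_succ, pow_succ', Finset.mul_sum,
    mul_assoc]

variable [DecidableEq S] [DecidableEq A]

lemma episodeProb_eq_zero_of_ne {p : Fin H → S → A → S → ℝ} {π : Policy S A H} {s₁ : S}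
    {z : Episode S A H} (hz : z.1 0 ≠ s₁) : episodeProb p π s₁ z = 0 := by
  simp [episodeProb, hz]

lemma transition_ne_zero_of_episodeProb_ne_zero {p : Fin H → S → A → S → ℝ} {π : Policy S A H}
    {s₁ : S} {z : Episode S A H} (hz : episodeProb p π s₁ z ≠ 0) (h : Fin H) :
    p h (z.1 h.castSucc) (z.2 h) (z.1 h.succ) ≠ 0 :=
  right_ne_zero_of_mul (Finset.prod_ne_zero_iff.1 (right_ne_zero_of_mul hz) h (Finset.mem_univ h))

lemma episodeProb_cons (p : Fin (H + 1) → S → A → S → ℝ) (π : Policy S A (H + 1)) (s₁ s : S)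
    (a : A) (z : Episode S A H) :
    episodeProb p π s₁ (Episode.cons s a z) = if s = s₁ then if a = π 0 s then
      p 0 s a (z.1 0) * episodeProb (Fin.tail p) (Fin.tail π) (z.1 0) z else 0 else 0 := by
  simp only [episodeProb, Episode.cons, Fin.tail, Fin.prod_univ_succ, Fin.cons_zero, Fin.cons_succ,
    Fin.castSucc_zero, ← Fin.succ_castSucc]
  split_ifs <;> simp only [one_mul, zero_mul, mul_zero]
  rfl

variable [Fintype S]

lemma episodeProb_nonneg {p : Fin H → S → A → S → ℝ} (hp : ∀ h s a, p h s a ∈ stdSimplex ℝ S)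
    (π : Policy S A H) (s₁ : S) (z : Episode S A H) : 0 ≤ episodeProb p π s₁ z :=
  mul_nonneg (by split_ifs <;> simp) <| Finset.prod_nonneg fun h _ =>
    mul_nonneg (by split_ifs <;> simp) ((hp h _ _).1 _)

variable [Fintype A]

/-- The expectation of `F` over an episode of `π`. -/
def episodeMean (p : Fin H → S → A → S → ℝ) (π : Policy S A H) (s₁ : S)
    (F : Episode S A H → ℝ) : ℝ :=
  ∑ z, episodeProb p π s₁ z * F z

lemma value_eq_episodeMean (γ : ℝ) (r : Fin H → S → A → ℝ) (p : Fin H → S → A → S → ℝ)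
    (π : Policy S A H) (s₁ : S) :
    value γ r p π s₁ = episodeMean p π s₁ (episodeReturn γ r) :=
  rfl

lemma episodeMean_mono {p : Fin H → S → A → S → ℝ} (hp : ∀ h s a, p h s a ∈ stdSimplex ℝ S)
    (π : Policy S A H) (s₁ : S) {F G : Episode S A H → ℝ} (hFG : ∀ z, F z ≤ G z) :
    episodeMean p π s₁ F ≤ episodeMean p π s₁ G :=
  Finset.sum_le_sum fun z _ => mul_le_mul_of_nonneg_left (hFG z) (episodeProb_nonneg hp π s₁ z)

lemma episodeMean_congr_initial (p : Fin H → S → A → S → ℝ) (π : Policy S A H) (s₁ : S)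
    {F G : Episode S A H → ℝ} (hFG : ∀ z, z.1 0 = s₁ → F z = G z) :
    episodeMean p π s₁ F = episodeMean p π s₁ G := by
  refine Finset.sum_congr rfl fun z _ => ?_
  by_cases hz : z.1 0 = s₁
  · rw [hFG z hz]
  · simp [episodeProb_eq_zero_of_ne hz]

lemma episodeMean_cons (p : Fin (H + 1) → S → A → S → ℝ) (π : Policy S A (H + 1)) (s₁ : S)
    (F : Episode S A (H + 1) → ℝ) :
    episodeMean p π s₁ F = ∑ s', p 0 s₁ (π 0 s₁) s' *
      episodeMean (Fin.tail p) (Fin.tail π) s' fun z => F (Episode.cons s₁ (π 0 s₁) z) := by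
  have sum_initial (z : Episode S A H) (s' : S) (hs' : s' ≠ z.1 0) :
      p 0 s₁ (π 0 s₁) s' * (episodeProb (Fin.tail p) (Fin.tail π) s' z *
        F (Episode.cons s₁ (π 0 s₁) z)) = 0 := by
    simp [episodeProb_eq_zero_of_ne hs'.symm]
  unfold episodeMean
  simp only [← Episode.consEquiv.sum_comp, Fintype.sum_prod_type (α₁ := S),
    Fintype.sum_prod_type (α₁ := A), Episode.consEquiv, Equiv.coe_fn_mk, episodeProb_cons,
    ite_mul, zero_mul, Finset.sum_ite_irrel, Finset.sum_const_zero, Finset.sum_ite_eq',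
    Finset.mem_univ, if_true, Finset.mul_sum]
  rw [Finset.sum_comm]
  exact Finset.sum_congr rfl fun z _ => by
    rw [Fintype.sum_eq_single (z.1 0) (sum_initial z), mul_assoc]

lemma episodeMean_const {p : Fin H → S → A → S → ℝ} (hp : ∀ h s a, p h s a ∈ stdSimplex ℝ S)
    (π : Policy S A H) (s₁ : S) (c : ℝ) : episodeMean p π s₁ (fun _ => c) = c := by
  induction H generalizing s₁ with
  | zero =>
    unfold episodeMean
    rw [Fintype.sum_prod_type, ← (Equiv.funUnique (Fin 1) S).symm.sum_comp]
    simp [episodeProb]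
  | succ H ih =>
    simp_rw [episodeMean_cons, ih (p := Fin.tail p) fun h => hp h.succ,
      ← Finset.sum_mul, (hp 0 _ _).2, one_mul]

lemma episodeMean_const_add_mul {p : Fin H → S → A → S → ℝ}
    (hp : ∀ h s a, p h s a ∈ stdSimplex ℝ S) (π : Policy S A H) (s₁ : S) (c d : ℝ)
    (F : Episode S A H → ℝ) :
    episodeMean p π s₁ (fun z => c + d * F z) = c + d * episodeMean p π s₁ F := by
  conv_rhs => rw [← episodeMean_const hp π s₁ c]
  simp_rw [episodeMean, Finset.mul_sum, ← Finset.sum_add_distrib, mul_add, mul_left_comm]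

lemma episodeMean_transition {p : Fin H → S → A → S → ℝ}
    (hp : ∀ h s a, p h s a ∈ stdSimplex ℝ S) (π : Policy S A H) (s₁ : S) (h : Fin H)
    (g : S → A → S → ℝ) :
    episodeMean p π s₁ (fun z => g (z.1 h.castSucc) (z.2 h) (z.1 h.succ)) =
      episodeMean p π s₁ fun z =>
        ∑ s', p h (z.1 h.castSucc) (z.2 h) s' * g (z.1 h.castSucc) (z.2 h) s' := by
  induction H generalizing s₁ with
  | zero => exact h.elim0
  | succ H ih =>
    have hp_tail : ∀ h s a, Fin.tail p h s a ∈ stdSimplex ℝ S := fun h => hp h.succ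
    simp only [episodeMean_cons, Episode.cons]
    induction h using Fin.cases with
    | zero =>
      simp only [Fin.castSucc_zero, Fin.cons_zero, Fin.cons_succ,
        episodeMean_const hp_tail, ← Finset.sum_mul, (hp 0 _ _).2, one_mul]
      refine Finset.sum_congr rfl fun s' _ => ?_
      rw [episodeMean_congr_initial (G := fun _ => g s₁ (π 0 s₁) s') _ _ _ fun z hz => by rw [hz],
        episodeMean_const hp_tail]
    | succ h =>
      simp only [← Fin.succ_castSucc, Fin.cons_succ]
      exact Finset.sum_congr rfl fun s' _ => congrArg _ (ih hp_tail _ s' h)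

lemma value_succ {p : Fin (H + 1) → S → A → S → ℝ} (hp : ∀ h s a, p h s a ∈ stdSimplex ℝ S)
    (γ : ℝ) (r : Fin (H + 1) → S → A → ℝ) (π : Policy S A (H + 1)) (s₁ : S) :
    value γ r p π s₁ = r 0 s₁ (π 0 s₁) + γ * ∑ s', p 0 s₁ (π 0 s₁) s' *
      value γ (Fin.tail r) (Fin.tail p) (Fin.tail π) s' := by
  simp_rw [value_eq_episodeMean, episodeMean_cons, episodeReturn_cons,
    episodeMean_const_add_mul (p := Fin.tail p) fun h => hp h.succ, mul_add, Finset.sum_add_distrib,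
    ← Finset.sum_mul, (hp 0 _ _).2, one_mul, Finset.mul_sum, mul_left_comm]

lemma value_le_of_bellman {γ : ℝ} (hγ : 0 ≤ γ) {r : Fin H → S → A → ℝ}
    {p : Fin H → S → A → S → ℝ} (hp : ∀ h s a, p h s a ∈ stdSimplex ℝ S) (π : Policy S A H)
    (W : Fin (H + 1) → S → ℝ) (hlast : ∀ s, 0 ≤ W (Fin.last H) s)
    (hW : ∀ h s, r h s (π h s) + γ * ∑ s', p h s (π h s) s' * W h.succ s' ≤ W h.castSucc s)
    (s₁ : S) : value γ r p π s₁ ≤ W 0 s₁ := by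
  induction H generalizing s₁ with
  | zero => simpa [value, episodeReturn] using hlast s₁
  | succ H ih =>
    rw [value_succ hp]
    refine le_trans ?_ (hW 0 s₁)
    gcongr with s' _
    · exact (hp 0 _ _).1 _
    · exact ih (fun h => hp h.succ) (Fin.tail π) (Fin.tail W) hlast (fun h => hW h.succ) s'

lemma value_const_mul (γ c : ℝ) (r : Fin H → S → A → ℝ) (p : Fin H → S → A → S → ℝ)
    (π : Policy S A H) (s₁ : S) :
    value γ (fun h s a => c * r h s a) p π s₁ = c * value γ r p π s₁ := by
  simp_rw [value, episodeReturn, Finset.mul_sum, mul_left_comm]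

lemma le_value_of_bellman {γ : ℝ} (hγ : 0 ≤ γ) {r : Fin H → S → A → ℝ}
    {p : Fin H → S → A → S → ℝ} (hp : ∀ h s a, p h s a ∈ stdSimplex ℝ S) (π : Policy S A H)
    (W : Fin (H + 1) → S → ℝ) (hlast : ∀ s, W (Fin.last H) s ≤ 0)
    (hW : ∀ h s, W h.castSucc s ≤ r h s (π h s) + γ * ∑ s', p h s (π h s) s' * W h.succ s')
    (s₁ : S) : W 0 s₁ ≤ value γ r p π s₁ := by
  have h_neg : value γ (fun h s a => -1 * r h s a) p π s₁ ≤ (-W) 0 s₁ := by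
    refine value_le_of_bellman hγ hp π (-W) (fun s => neg_nonneg.2 (hlast s)) (fun h s => ?_) s₁
    simp only [Pi.neg_apply, mul_neg, Finset.sum_neg_distrib]
    linarith [hW h s]
  rw [value_const_mul, neg_one_mul] at h_neg
  exact neg_le_neg_iff.1 h_neg

/-- The probability that `π` plays `a` in state `s` in step `h`. -/
def occupancy (p : Fin H → S → A → S → ℝ) (π : Policy S A H) (s₁ : S) (h : Fin H) (s : S)
    (a : A) : ℝ :=
  episodeMean p π s₁ fun z => if z.1 h.castSucc = s ∧ z.2 h = a then 1 else 0

lemma occupancy_nonneg {p : Fin H → S → A → S → ℝ} (hp : ∀ h s a, p h s a ∈ stdSimplex ℝ S)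
    (π : Policy S A H) (s₁ : S) (h : Fin H) (s : S) (a : A) : 0 ≤ occupancy p π s₁ h s a :=
  Finset.sum_nonneg fun z _ => mul_nonneg (episodeProb_nonneg hp π s₁ z)
    (by dsimp only; split_ifs <;> simp)

lemma episodeMean_visit (p : Fin H → S → A → S → ℝ) (π : Policy S A H) (s₁ : S) (h : Fin H)
    (g : S → A → ℝ) :
    episodeMean p π s₁ (fun z => g (z.1 h.castSucc) (z.2 h)) =
      ∑ x : S × A, occupancy p π s₁ h x.1 x.2 * g x.1 x.2 := by
  simp only [occupancy, episodeMean, Finset.sum_mul]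
  rw [Finset.sum_comm]
  simp [Fintype.sum_prod_type, ite_and]

lemma sum_occupancy {p : Fin H → S → A → S → ℝ} (hp : ∀ h s a, p h s a ∈ stdSimplex ℝ S)
    (π : Policy S A H) (s₁ : S) (h : Fin H) :
    ∑ x : S × A, occupancy p π s₁ h x.1 x.2 = 1 := by
  simpa [episodeMean_const hp] using (episodeMean_visit p π s₁ h fun _ _ => 1).symm

lemma occupancy_le_one {p : Fin H → S → A → S → ℝ} (hp : ∀ h s a, p h s a ∈ stdSimplex ℝ S)
    (π : Policy S A H) (s₁ : S) (h : Fin H) (s : S) (a : A) : occupancy p π s₁ h s a ≤ 1 := by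
  rw [← sum_occupancy hp π s₁ h]
  exact Finset.single_le_sum (f := fun x : S × A => occupancy p π s₁ h x.1 x.2)
    (fun x _ => occupancy_nonneg hp π s₁ h x.1 x.2) (Finset.mem_univ (s, a))

lemma value_eq_sum_occupancy (γ : ℝ) (r : Fin H → S → A → ℝ) (p : Fin H → S → A → S → ℝ)
    (π : Policy S A H) (s₁ : S) :
    value γ r p π s₁ =
      ∑ h : Fin H, γ ^ (h : ℕ) * ∑ x : S × A, occupancy p π s₁ h x.1 x.2 * r h x.1 x.2 := by
  simp_rw [← episodeMean_visit, value, episodeReturn, episodeMean, Finset.mul_sum, mul_left_comm]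
  exact Finset.sum_comm

end Episodes

section Ville

variable {S A : Type*} {H : ℕ} {Ω : Type*}

/-- The data `D` followed by one more episode `e`. -/
def History.snoc {t : ℕ} (D : History S A H t) (e : Episode S A H) : History S A H (t + 1) :=
  Fin.snoc (α := fun _ => Episode S A H) D e

lemma historyOf_succ (Z : ℕ → Ω → Episode S A H) (t : ℕ) (ω : Ω) :
    historyOf Z (t + 1) ω = (historyOf Z t ω).snoc (Z t ω) := by
  funext i
  refine Fin.lastCases ?_ (fun i => ?_) i <;> simp [historyOf, History.snoc]

lemma historyOf_eq_iff (Z : ℕ → Ω → Episode S A H) (t : ℕ) (ω : Ω) (z : ℕ → Episode S A H) :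
    (historyOf Z t ω = fun i : Fin t => z i) ↔ ∀ i < t, Z i ω = z i := by
  simp [funext_iff, historyOf, Fin.forall_iff]

variable [DecidableEq S] [DecidableEq A] [MeasurableSpace Ω] {μ : Measure Ω}
  {alg : Algorithm S A H} {p : Fin H → S → A → S → ℝ} {s₁ : S} {Z : ℕ → Ω → Episode S A H}

lemma IsRun.real_historyOf_snoc (hZ : IsRun μ alg p s₁ Z) {t : ℕ} (D : History S A H t)
    (e : Episode S A H) :
    μ.real {ω | historyOf Z (t + 1) ω = D.snoc e} =
      μ.real {ω | historyOf Z t ω = D} * episodeProb p (alg.policy t D) s₁ e := by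
  let z : ℕ → Episode S A H := fun i => if h : i < t then D ⟨i, h⟩ else e
  have hD : D = fun i : Fin t => z i := by simp [z]
  have he : e = z t := by simp [z]
  have h_snoc : D.snoc e = fun i : Fin (t + 1) => z i := by
    funext i
    refine Fin.lastCases ?_ (fun i => ?_) i <;> simp [z, History.snoc]
  simp_rw [h_snoc, hD, he, historyOf_eq_iff, hZ.law, Finset.prod_range_succ]

lemma IsRun.ae_episodeProb_ne_zero [Countable S] [Countable A] [IsFiniteMeasure μ]
    (hZ : IsRun μ alg p s₁ Z) :
    ∀ᵐ ω ∂μ, ∀ t, episodeProb p (alg.policy t (historyOf Z t ω)) s₁ (Z t ω) ≠ 0 := by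
  have h_snoc (t : ℕ) (D : History S A H t) (e : Episode S A H) :
      ∀ᵐ ω ∂μ, episodeProb p (alg.policy t D) s₁ e = 0 → historyOf Z (t + 1) ω ≠ D.snoc e := by
    by_cases he : episodeProb p (alg.policy t D) s₁ e = 0
    · have h_null := hZ.real_historyOf_snoc D e
      rw [he, mul_zero, measureReal_eq_zero_iff] at h_null
      filter_upwards [measure_eq_zero_iff_ae_notMem.1 h_null] with ω hω _ using hω
    · exact .of_forall fun ω h => absurd h he
  simp_rw [← ae_all_iff] at h_snoc
  filter_upwards [h_snoc] with ω hω t h0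
  exact hω t _ _ h0 (historyOf_succ Z t ω)

variable [Fintype S] [Fintype A]

/-- A nonnegative function of the collected data whose conditional expectation never increases
when `alg` plays one more episode. -/
structure IsNonnegSupermartingale (alg : Algorithm S A H) (p : Fin H → S → A → S → ℝ) (s₁ : S)
    (f : (t : ℕ) → History S A H t → ℝ) : Prop where
  nonneg : ∀ t D, 0 ≤ f t D
  episodeMean_snoc_le : ∀ t D,
    episodeMean p (alg.policy t D) s₁ (fun e => f (t + 1) (D.snoc e)) ≤ f t D

variable [IsProbabilityMeasure μ] {f : (t : ℕ) → History S A H t → ℝ} {c : ℝ}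

lemma IsRun.real_historyOf_eq_and_exists_lt_le (hZ : IsRun μ alg p s₁ Z)
    (hf : IsNonnegSupermartingale alg p s₁ f) (hc : 0 < c) (k t : ℕ) (D : History S A H t) :
    μ.real {ω | historyOf Z t ω = D ∧ ∃ u < k, c ≤ f (t + u) (historyOf Z (t + u) ω)} ≤
      μ.real {ω | historyOf Z t ω = D} * (f t D / c) := by
  induction k generalizing t with
  | zero => simpa using mul_nonneg measureReal_nonneg (div_nonneg (hf.nonneg t D) hc.le)
  | succ k ih =>
    by_cases hD : c ≤ f t D
    · calc _ ≤ μ.real {ω | historyOf Z t ω = D} := measureReal_mono fun ω hω => hω.1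
        _ ≤ _ := le_mul_of_one_le_right measureReal_nonneg ((one_le_div hc).2 hD)
    have h_later : {ω | historyOf Z t ω = D ∧
        ∃ u < k + 1, c ≤ f (t + u) (historyOf Z (t + u) ω)} ⊆
          ⋃ e : Episode S A H, {ω | historyOf Z (t + 1) ω = D.snoc e ∧
            ∃ u < k, c ≤ f (t + 1 + u) (historyOf Z (t + 1 + u) ω)} := by
      rintro ω ⟨rfl, u, hu, hcu⟩
      refine Set.mem_iUnion.2 ⟨Z t ω, historyOf_succ Z t ω, ?_⟩
      obtain _ | u := u
      · exact absurd hcu hD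
      · exact ⟨u, by omega, by rwa [show t + 1 + u = t + (u + 1) by omega]⟩
    calc _ ≤ _ := measureReal_mono h_later
      _ ≤ ∑ e : Episode S A H, μ.real {ω | historyOf Z (t + 1) ω = D.snoc e ∧
            ∃ u < k, c ≤ f (t + 1 + u) (historyOf Z (t + 1 + u) ω)} :=
          measureReal_iUnion_fintype_le _
      _ ≤ ∑ e, μ.real {ω | historyOf Z t ω = D} *
            (episodeProb p (alg.policy t D) s₁ e * f (t + 1) (D.snoc e)) / c :=
          Finset.sum_le_sum fun e _ => (ih _ _).trans_eq <| by
            rw [hZ.real_historyOf_snoc]; ring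
      _ = μ.real {ω | historyOf Z t ω = D} *
            (episodeMean p (alg.policy t D) s₁ (fun e => f (t + 1) (D.snoc e)) / c) := by
          rw [← Finset.sum_div, ← Finset.mul_sum, mul_div_assoc, episodeMean]
      _ ≤ _ := by gcongr; exact hf.episodeMean_snoc_le t D

lemma IsRun.real_exists_le_supermartingale (hZ : IsRun μ alg p s₁ Z)
    (hf : IsNonnegSupermartingale alg p s₁ f) (hc : 0 < c) :
    μ.real {ω | ∃ t, c ≤ f t (historyOf Z t ω)} ≤ f 0 Fin.elim0 / c := by
  have h_mono : Monotone fun k : ℕ => {ω | ∃ u < k, c ≤ f u (historyOf Z u ω)} :=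
    fun k l hkl ω ⟨u, hu, hcu⟩ => ⟨u, hu.trans_le hkl, hcu⟩
  have h_iUnion : {ω | ∃ t, c ≤ f t (historyOf Z t ω)} =
      ⋃ k : ℕ, {ω | ∃ u < k, c ≤ f u (historyOf Z u ω)} := by
    ext ω
    simp only [Set.mem_iUnion]
    exact ⟨fun ⟨t, ht⟩ => ⟨t + 1, t, t.lt_succ_self, ht⟩, fun ⟨_, u, _, hu⟩ => ⟨u, hu⟩⟩
  have h_lim := (ENNReal.tendsto_toReal (measure_ne_top μ _)).comp
    (tendsto_measure_iUnion_atTop (μ := μ) h_mono)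
  have h_sub (k : ℕ) : {ω | ∃ u < k, c ≤ f u (historyOf Z u ω)} ⊆ {ω | historyOf Z 0 ω = Fin.elim0 ∧
      ∃ u < k, c ≤ f (0 + u) (historyOf Z (0 + u) ω)} := by
    rintro ω ⟨u, hu, hcu⟩
    exact ⟨Subsingleton.elim _ _, u, hu, by rwa [Nat.zero_add]⟩
  rw [h_iUnion]
  refine le_of_tendsto' h_lim fun k => ?_
  calc _ ≤ _ := measureReal_mono (h_sub k)
    _ ≤ μ.real {ω | historyOf Z 0 ω = Fin.elim0} * (f 0 Fin.elim0 / c) :=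
        hZ.real_historyOf_eq_and_exists_lt_le hf hc k 0 Fin.elim0
    _ ≤ f 0 Fin.elim0 / c :=
        mul_le_of_le_one_left (div_nonneg (hf.nonneg 0 _) hc.le) measureReal_le_one

end Ville

section Mixture

variable {S : Type*} [Fintype S]

/-- The likelihood, for data with counts `k`, of the uniform mixture of all probability vectors on
`S`, divided by that of the probability vector `q`. The Dirichlet integral turns the mixture into
factorials. -/
def mixtureRatio (q : S → ℝ) (k : S → ℕ) : ℝ :=
  ((Fintype.card S - 1).factorial * ∏ s, ((k s).factorial : ℝ)) /
    ((∑ s, k s + (Fintype.card S - 1)).factorial * ∏ s, q s ^ k s)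

lemma mixtureRatio_nonneg {q : S → ℝ} (hq : ∀ s, 0 ≤ q s) (k : S → ℕ) :
    0 ≤ mixtureRatio q k := by
  have : 0 ≤ ∏ s, q s ^ k s := Finset.prod_nonneg fun s _ => pow_nonneg (hq s) _
  unfold mixtureRatio
  positivity

lemma mixtureRatio_zero (q : S → ℝ) : mixtureRatio q 0 = 1 := by
  simp [mixtureRatio, Nat.factorial_ne_zero]

section Update

variable [DecidableEq S]

lemma mixtureRatio_add_single (q : S → ℝ) (k : S → ℕ) (s : S) :
    mixtureRatio q (k + Pi.single s 1) =
      mixtureRatio q k * ((k s + 1) / ((∑ x, k x : ℕ) + Fintype.card S) / q s) := by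
  have hS : 0 < Fintype.card S := Fintype.card_pos_iff.2 ⟨s⟩
  have h_factorial : ∏ x, (((k + Pi.single s 1 : S → ℕ) x).factorial : ℝ) =
      (∏ x, ((k x).factorial : ℝ)) * (k s + 1) := by
    have h_factor (x : S) : (((k + Pi.single s 1 : S → ℕ) x).factorial : ℝ) =
        (k x).factorial * if s = x then (k x + 1 : ℝ) else 1 := by
      rcases eq_or_ne s x with rfl | hx
      · simp [Nat.factorial_succ, mul_comm]
      · simp [hx, hx.symm]
    simp_rw [h_factor, Finset.prod_mul_distrib, Finset.prod_ite_eq, Finset.mem_univ, if_true]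
  have h_likelihood : ∏ x, q x ^ (k + Pi.single s 1 : S → ℕ) x = (∏ x, q x ^ k x) * q s := by
    simp_rw [Pi.add_apply, pow_add, Finset.prod_mul_distrib]
    simp [Pi.single_apply, pow_ite]
  have h_sum : ∑ x, (k + Pi.single s 1 : S → ℕ) x + (Fintype.card S - 1) =
      ∑ x, k x + (Fintype.card S - 1) + 1 := by
    simp [Finset.sum_add_distrib, add_right_comm]
  have h_cast : ((∑ x, k x + (Fintype.card S - 1) + 1 : ℕ) : ℝ) =
      (∑ x, k x : ℕ) + Fintype.card S := by
    rw [add_assoc, Nat.sub_add_cancel hS, Nat.cast_add]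
  rw [mixtureRatio, h_factorial, h_likelihood, h_sum, Nat.factorial_succ, Nat.cast_mul, h_cast,
    mixtureRatio]
  simp only [div_eq_mul_inv, mul_inv]
  ring

lemma sum_mul_mixtureRatio_le {q : S → ℝ} (hq : q ∈ stdSimplex ℝ S) (k : S → ℕ) :
    ∑ s, q s * mixtureRatio q (k + Pi.single s 1) ≤ mixtureRatio q k := by
  set N : ℝ := (∑ x, k x : ℕ) + Fintype.card S with hN
  have h_term (s : S) :
      q s * mixtureRatio q (k + Pi.single s 1) ≤ mixtureRatio q k * ((k s + 1) / N) := by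
    rw [mixtureRatio_add_single, mul_left_comm, mul_div_left_comm]
    refine mul_le_mul_of_nonneg_left ?_ (mixtureRatio_nonneg hq.1 k)
    exact mul_le_of_le_one_right (by positivity) (div_self_le_one _)
  have h_sum : ∑ s, ((k s : ℝ) + 1) / N ≤ 1 := by
    rw [← Finset.sum_div, Finset.sum_add_distrib]
    simpa [hN] using div_self_le_one N
  calc _ ≤ ∑ s, mixtureRatio q k * ((k s + 1) / N) := Finset.sum_le_sum fun s _ => h_term s
    _ = mixtureRatio q k * ∑ s, (k s + 1) / N := (Finset.mul_sum ..).symm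
    _ ≤ mixtureRatio q k := mul_le_of_le_one_right (mixtureRatio_nonneg hq.1 k) h_sum

end Update

lemma factorial_div_mul_prod_le_one {k : S → ℕ} (hk : 0 < ∑ s, k s) :
    ((∑ s, k s).factorial : ℝ) / (∏ s, ((k s).factorial : ℝ)) *
      ∏ s, ((k s : ℝ) / (∑ x, k x : ℕ)) ^ k s ≤ 1 := by
  classical
  set n := ∑ s, k s with hn
  have h_multinomial : (n.factorial : ℝ) / (∏ s, ((k s).factorial : ℝ)) =
      Nat.multinomial Finset.univ k := by
    rw [div_eq_iff (Finset.prod_ne_zero_iff.2 fun s _ => by positivity), mul_comm]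
    exact_mod_cast (Nat.multinomial_spec Finset.univ k).symm
  have h_sum : ∑ s, (k s : ℝ) / (n : ℝ) = 1 := by
    rw [← Finset.sum_div, ← Nat.cast_sum, div_self (by positivity)]
  have h_expand := Finset.sum_pow_eq_sum_piAntidiag Finset.univ (fun s => (k s : ℝ) / (n : ℝ)) n
  rw [h_sum, one_pow] at h_expand
  rw [h_multinomial, h_expand]
  refine Finset.single_le_sum (f := fun l : S → ℕ => (Nat.multinomial Finset.univ l : ℝ) *
    ∏ s, ((k s : ℝ) / (n : ℝ)) ^ l s) (fun l _ => by positivity) ?_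
  simp [Finset.mem_piAntidiag, hn]

lemma prod_pow_div_prod_pow_le_mixtureRatio {q : S → ℝ} (hq : ∀ s, 0 ≤ q s) {k : S → ℕ}
    (hk : 0 < ∑ s, k s) :
    (∏ s, ((k s : ℝ) / (∑ x, k x : ℕ)) ^ k s) / ∏ s, q s ^ k s ≤
      mixtureRatio q k *
        (∑ s, k s + (Fintype.card S - 1)).choose (Fintype.card S - 1) := by
  have h_prod := factorial_div_mul_prod_le_one hk
  have hF : (0 : ℝ) < ∏ s, ((k s).factorial : ℝ) := Finset.prod_pos fun s _ => by positivity
  have hQ : 0 ≤ ∏ s, q s ^ k s := Finset.prod_nonneg fun s _ => pow_nonneg (hq s) _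
  rw [div_mul_eq_mul_div, div_le_one hF, ← le_div_iff₀' (by positivity)] at h_prod
  refine (div_le_div_of_nonneg_right h_prod hQ).trans_eq ?_
  rw [mixtureRatio, ← Nat.choose_symm_add, Nat.cast_add_choose]
  field_simp

lemma log_choose_add_le (n m : ℕ) :
    Real.log ((n + m).choose m : ℝ) ≤ m * Real.log (Real.exp 1 * (1 + (n : ℝ) / m)) := by
  rcases m.eq_zero_or_pos with rfl | hm
  · simp
  rw [← Real.log_pow]
  refine Real.log_le_log (by exact_mod_cast Nat.choose_pos (by omega)) ?_
  calc ((n + m).choose m : ℝ) ≤ ((n + m : ℕ) : ℝ) ^ m / m.factorial := Nat.choose_le_pow_div _ _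
    _ = (m : ℝ) ^ m / m.factorial * (((n + m : ℕ) : ℝ) / m) ^ m := by
        rw [div_pow]
        field_simp
    _ ≤ Real.exp m * (((n + m : ℕ) : ℝ) / m) ^ m := by
        gcongr
        exact Real.pow_div_factorial_le_exp (m : ℝ) m.cast_nonneg m
    _ = (Real.exp 1 * (1 + (n : ℝ) / m)) ^ m := by
        rw [mul_pow, ← Real.exp_nat_mul, mul_one, Nat.cast_add, add_div,
          div_self (by positivity), add_comm]

lemma sum_div_mul_log_div_div {q : S → ℝ} {k : S → ℕ} (hqk : ∀ s, q s = 0 → k s = 0) {n : ℝ}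
    (hn : n ≠ 0) :
    ∑ s, (k s : ℝ) / n * Real.log ((k s : ℝ) / n / q s) =
      Real.log ((∏ s, ((k s : ℝ) / n) ^ k s) / ∏ s, q s ^ k s) / n := by
  have h_ne (s : S) : ((k s : ℝ) / n / q s) ^ k s ≠ 0 := by
    by_cases hs : k s = 0
    · simp [hs]
    · exact pow_ne_zero _ (div_ne_zero (div_ne_zero (by exact_mod_cast hs) hn) (mt (hqk s) hs))
  simp_rw [← Finset.prod_div_distrib, ← div_pow]
  rw [Real.log_prod fun s _ => h_ne s, Finset.sum_div]
  simp_rw [Real.log_pow, div_mul_eq_mul_div]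

lemma kl_le_of_mixtureRatio_le {q : S → ℝ} (hq : ∀ s, 0 ≤ q s) {k : S → ℕ}
    (hqk : ∀ s, q s = 0 → k s = 0) (hk : 0 < ∑ s, k s) {c : ℝ} (hc : mixtureRatio q k ≤ c) :
    kl (fun s => (k s : ℝ) / (∑ x, k x : ℕ)) q ≤
      (((Real.log c + ((Fintype.card S : ℝ) - 1) * Real.log (Real.exp 1 *
        (1 + (∑ x, k x : ℕ) / ((Fintype.card S : ℝ) - 1)))) / (∑ x, k x : ℕ) : ℝ) : EReal) := by
  have hS : 1 ≤ Fintype.card S := by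
    obtain ⟨s, -, -⟩ := Finset.exists_ne_zero_of_sum_ne_zero hk.ne'
    exact Fintype.card_pos_iff.2 ⟨s⟩
  set n := ∑ s, k s
  have hn : (0 : ℝ) < n := by exact_mod_cast hk
  have hP : 0 < ∏ s, ((k s : ℝ) / n) ^ k s := Finset.prod_pos fun s _ => by
    rcases (k s).eq_zero_or_pos with hs | hs
    · simp [hs]
    · positivity
  have hQ : 0 < ∏ s, q s ^ k s := Finset.prod_pos fun s _ => by
    rcases (hq s).eq_or_lt with hs | hs
    · simp [hqk s hs.symm]
    · positivity
  have h_ratio := (prod_pow_div_prod_pow_le_mixtureRatio hq hk).trans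
    (mul_le_mul_of_nonneg_right hc (Nat.cast_nonneg _))
  have h_choose : (0 : ℝ) < (n + (Fintype.card S - 1)).choose (Fintype.card S - 1) := by
    exact_mod_cast Nat.choose_pos (by omega)
  have hc0 : c ≠ 0 := left_ne_zero_of_mul ((div_pos hP hQ).trans_le h_ratio).ne'
  rw [kl, if_pos fun s hs => by simp [hqk s hs], EReal.coe_le_coe_iff,
    sum_div_mul_log_div_div hqk hn.ne']
  gcongr
  calc _ ≤ Real.log (c * (n + (Fintype.card S - 1)).choose (Fintype.card S - 1)) :=
        Real.log_le_log (div_pos hP hQ) h_ratio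
    _ = Real.log c + Real.log ((n + (Fintype.card S - 1)).choose (Fintype.card S - 1)) :=
        Real.log_mul hc0 h_choose.ne'
    _ ≤ _ := by
        gcongr
        simpa [Nat.cast_sub hS] using log_choose_add_le n (Fintype.card S - 1)

end Mixture

section Concentration

variable {S A : Type*} [DecidableEq S] [DecidableEq A] {H t : ℕ}

lemma count_snoc (D : History S A H t) (e : Episode S A H) (h : Fin H) (s : S) (a : A) :
    count (D.snoc e) h s a =
      count D h s a + if e.1 h.castSucc = s ∧ e.2 h = a then 1 else 0 := by
  simp_rw [count, Finset.card_filter, Fin.sum_univ_castSucc, History.snoc, Fin.snoc_castSucc,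
    Fin.snoc_last]

lemma countNext_snoc (D : History S A H t) (e : Episode S A H) (h : Fin H) (s : S) (a : A) :
    countNext (D.snoc e) h s a = if e.1 h.castSucc = s ∧ e.2 h = a then
      countNext D h s a + Pi.single (e.1 h.succ) 1 else countNext D h s a := by
  funext s'
  have h_count : countNext (D.snoc e) h s a s' = countNext D h s a s' +
      if e.1 h.castSucc = s ∧ e.2 h = a ∧ e.1 h.succ = s' then 1 else 0 := by
    simp_rw [countNext, Finset.card_filter, Fin.sum_univ_castSucc, History.snoc,
      Fin.snoc_castSucc, Fin.snoc_last]
  rw [h_count]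
  by_cases h_visit : e.1 h.castSucc = s ∧ e.2 h = a
  · simp [h_visit, Pi.single_apply, eq_comm]
  · simp [← and_assoc, h_visit]

lemma sum_countNext [Fintype S] (D : History S A H t) (h : Fin H) (s : S) (a : A) :
    ∑ s', countNext D h s a s' = count D h s a := by
  simp_rw [countNext, count, ← and_assoc, ← Finset.filter_filter]
  exact (Finset.card_eq_sum_card_fiberwise fun _ _ => Finset.mem_univ _).symm

lemma count_le (D : History S A H t) (h : Fin H) (s : S) (a : A) : count D h s a ≤ t :=
  (Finset.card_filter_le _ _).trans_eq (by simp)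

variable {Ω : Type*} [MeasurableSpace Ω] {μ : Measure Ω} {alg : Algorithm S A H}
  {p : Fin H → S → A → S → ℝ} {s₁ : S} {Z : ℕ → Ω → Episode S A H}

lemma IsRun.ae_countNext_eq_zero [Countable S] [Countable A] [IsFiniteMeasure μ]
    (hZ : IsRun μ alg p s₁ Z) :
    ∀ᵐ ω ∂μ, ∀ t h s a s', p h s a s' = 0 → countNext (historyOf Z t ω) h s a s' = 0 := by
  filter_upwards [hZ.ae_episodeProb_ne_zero] with ω hω t h s a s' h0
  refine Finset.card_eq_zero.2 (Finset.filter_eq_empty_iff.2 ?_)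
  rintro i - ⟨rfl, rfl, rfl⟩
  exact transition_ne_zero_of_episodeProb_ne_zero (hω i) h h0

variable [Fintype S]

lemma mem_confRegion_of_mixtureRatio_le [Fintype A] {δ : ℝ} {D : History S A H t} {h : Fin H}
    {s : S} {a : A} {q : S → ℝ} (hq : q ∈ stdSimplex ℝ S)
    (hqD : ∀ s', q s' = 0 → countNext D h s a s' = 0)
    (h_ratio : mixtureRatio q (countNext D h s a) ≤
      2 * Fintype.card S * Fintype.card A * H / δ) :
    q ∈ confRegion δ D h s a := by
  refine ⟨hq, ?_⟩
  unfold radius empirical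
  by_cases h0 : count D h s a = 0
  · simp [h0]
  · have h_kl := kl_le_of_mixtureRatio_le hq.1 hqD
      (by rw [sum_countNext]; exact Nat.pos_of_ne_zero h0) h_ratio
    rw [sum_countNext] at h_kl
    simp only [h0, if_false]
    exact h_kl

lemma isNonnegSupermartingale_mixtureRatio [Fintype A] (hp : ∀ h s a, p h s a ∈ stdSimplex ℝ S)
    (alg : Algorithm S A H) (s₁ : S) (h : Fin H) (s : S) (a : A) :
    IsNonnegSupermartingale alg p s₁ fun _ D => mixtureRatio (p h s a) (countNext D h s a) where
  nonneg _ _ := mixtureRatio_nonneg (hp h s a).1 _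
  episodeMean_snoc_le t D := by
    let k := countNext D h s a
    let ratio (u : S) (b : A) (s' : S) : ℝ :=
      mixtureRatio (p h s a) (if u = s ∧ b = a then k + Pi.single s' 1 else k)
    have h_ratio (u : S) (b : A) :
        ∑ s', p h u b s' * ratio u b s' ≤ mixtureRatio (p h s a) k := by
      by_cases hub : u = s ∧ b = a
      · simpa [ratio, hub] using sum_mul_mixtureRatio_le (hp h s a) k
      · simp [ratio, hub, ← Finset.sum_mul, (hp h u b).2]
    simp_rw [countNext_snoc]
    calc _ = _ := episodeMean_transition hp _ s₁ h ratio
      _ ≤ episodeMean p (alg.policy t D) s₁ fun _ => mixtureRatio (p h s a) k :=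
          episodeMean_mono hp _ _ fun e => h_ratio _ _
      _ = mixtureRatio (p h s a) k := episodeMean_const hp _ _ _

lemma IsRun.real_exists_le_mixtureRatio_le [Finite A] [IsProbabilityMeasure μ]
    (hp : ∀ h s a, p h s a ∈ stdSimplex ℝ S) (hZ : IsRun μ alg p s₁ Z) (h : Fin H) (s : S) (a : A)
    {c : ℝ} (hc : 0 < c) :
    μ.real {ω | ∃ t, c ≤ mixtureRatio (p h s a) (countNext (historyOf Z t ω) h s a)} ≤ 1 / c := by
  have := Fintype.ofFinite A
  have h_zero : countNext (Fin.elim0 : History S A H 0) h s a = 0 := by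
    funext s'
    simp [countNext]
  simpa only [h_zero, mixtureRatio_zero] using hZ.real_exists_le_supermartingale
    (isNonnegSupermartingale_mixtureRatio hp alg s₁ h s a) hc

variable [Fintype A]

/-- The expected number of visits of `(s, a)` in step `h`, given the policies played. -/
def pseudoCount (alg : Algorithm S A H) (p : Fin H → S → A → S → ℝ) (s₁ : S) (h : Fin H)
    (s : S) (a : A) : (t : ℕ) → History S A H t → ℝ
  | 0, _ => 0
  | t + 1, D => pseudoCount alg p s₁ h s a t (Fin.init D) +
      occupancy p (alg.policy t (Fin.init D)) s₁ h s a

lemma pseudoCount_snoc (D : History S A H t) (e : Episode S A H) (h : Fin H) (s : S) (a : A) :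
    pseudoCount alg p s₁ h s a (t + 1) (D.snoc e) =
      pseudoCount alg p s₁ h s a t D + occupancy p (alg.policy t D) s₁ h s a := by
  rw [pseudoCount, History.snoc, Fin.init_snoc]

lemma pseudoCount_historyOf {Ω : Type*} (Z : ℕ → Ω → Episode S A H) (t : ℕ) (ω : Ω) (h : Fin H)
    (s : S) (a : A) :
    pseudoCount alg p s₁ h s a t (historyOf Z t ω) =
      ∑ i ∈ Finset.range t, occupancy p (alg.policy i (historyOf Z i ω)) s₁ h s a := by
  induction t with
  | zero => rfl
  | succ t ih => rw [historyOf_succ, pseudoCount_snoc, ih, Finset.sum_range_succ]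

lemma one_add_exp_neg_one_sub_one_mul_le {x : ℝ} (hx : 0 ≤ x) :
    1 + (Real.exp (-1) - 1) * x ≤ Real.exp (-(x / 2)) := by
  nlinarith [Real.exp_neg_one_lt_half, Real.add_one_le_exp (-(x / 2))]

lemma isNonnegSupermartingale_exp_pseudoCount (hp : ∀ h s a, p h s a ∈ stdSimplex ℝ S)
    (alg : Algorithm S A H) (s₁ : S) (h : Fin H) (s : S) (a : A) :
    IsNonnegSupermartingale alg p s₁ fun t D =>
      Real.exp (pseudoCount alg p s₁ h s a t D / 2 - count D h s a) where
  nonneg _ _ := (Real.exp_pos _).le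
  episodeMean_snoc_le t D := by
    set x := occupancy p (alg.policy t D) s₁ h s a with hx
    set c := Real.exp (pseudoCount alg p s₁ h s a t D / 2 - count D h s a) with hc
    have h_snoc (e : Episode S A H) :
        Real.exp (pseudoCount alg p s₁ h s a (t + 1) (D.snoc e) / 2 - count (D.snoc e) h s a) =
          c * Real.exp (x / 2) + c * Real.exp (x / 2) * (Real.exp (-1) - 1) *
            if e.1 h.castSucc = s ∧ e.2 h = a then 1 else 0 := by
      rw [count_snoc, pseudoCount_snoc, ← hx, hc]
      split_ifs
      · rw [mul_one, ← mul_one_add, add_sub_cancel, ← Real.exp_add, ← Real.exp_add]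
        push_cast
        ring_nf
      · rw [mul_zero, add_zero, ← Real.exp_add]
        ring_nf
    simp_rw [h_snoc]
    rw [episodeMean_const_add_mul hp]
    calc _ = c * Real.exp (x / 2) * (1 + (Real.exp (-1) - 1) * x) := by rw [hx, occupancy]; ring
      _ ≤ c * Real.exp (x / 2) * Real.exp (-(x / 2)) := by
          gcongr
          exact one_add_exp_neg_one_sub_one_mul_le (occupancy_nonneg hp _ _ _ _ _)
      _ = c := by rw [mul_assoc, ← Real.exp_add, add_neg_cancel, Real.exp_zero, mul_one]

lemma IsRun.real_exists_le_pseudoCount_sub_count_le [IsProbabilityMeasure μ]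
    (hp : ∀ h s a, p h s a ∈ stdSimplex ℝ S) (hZ : IsRun μ alg p s₁ Z) (h : Fin H) (s : S) (a : A)
    (L : ℝ) :
    μ.real {ω | ∃ t, L ≤ pseudoCount alg p s₁ h s a t (historyOf Z t ω) / 2 -
      count (historyOf Z t ω) h s a} ≤ 1 / Real.exp L := by
  simpa [pseudoCount, count] using hZ.real_exists_le_supermartingale
    (isNonnegSupermartingale_exp_pseudoCount hp alg s₁ h s a) (Real.exp_pos L)

/-- The good event: all confidence regions contain the transition probabilities, and no count is
much smaller than its conditional expectation. -/
structure IsRegular (alg : Algorithm S A H) (p : Fin H → S → A → S → ℝ) (s₁ : S) (δ : ℝ)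
    (Z : ℕ → Ω → Episode S A H) (ω : Ω) : Prop where
  mem_confRegion : ∀ t h s a, p h s a ∈ confRegion δ (historyOf Z t ω) h s a
  pseudoCount_sub_le_count : ∀ t h s a, pseudoCount alg p s₁ h s a t (historyOf Z t ω) / 2 -
    Real.log (2 * Fintype.card S * Fintype.card A * H / δ) ≤ count (historyOf Z t ω) h s a

lemma IsRun.ae_isRegular_or_exists (hp : ∀ h s a, p h s a ∈ stdSimplex ℝ S)
    [IsFiniteMeasure μ] (hZ : IsRun μ alg p s₁ Z) (δ : ℝ) :
    ∀ᵐ ω ∂μ, ¬ IsRegular alg p s₁ δ Z ω → ∃ x : Fin H × S × A,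
      (∃ t, 2 * Fintype.card S * Fintype.card A * H / δ ≤
        mixtureRatio (p x.1 x.2.1 x.2.2) (countNext (historyOf Z t ω) x.1 x.2.1 x.2.2)) ∨
      ∃ t, Real.log (2 * Fintype.card S * Fintype.card A * H / δ) ≤
        pseudoCount alg p s₁ x.1 x.2.1 x.2.2 t (historyOf Z t ω) / 2 -
          count (historyOf Z t ω) x.1 x.2.1 x.2.2 := by
  filter_upwards [hZ.ae_countNext_eq_zero] with ω hω
  contrapose!
  intro h_lt
  exact ⟨fun t h s a => mem_confRegion_of_mixtureRatio_le (hp h s a) (hω t h s a)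
      ((h_lt (h, s, a)).1 t).le,
    fun t h s a => sub_le_comm.1 ((h_lt (h, s, a)).2 t).le⟩

theorem IsRun.one_sub_le_real_isRegular [IsProbabilityMeasure μ] [Nonempty A]
    (hp : ∀ h s a, p h s a ∈ stdSimplex ℝ S) (hZ : IsRun μ alg p s₁ Z) {δ : ℝ} (hδ : 0 < δ)
    (hH : 0 < H) :
    1 - δ ≤ μ.real {ω | IsRegular alg p s₁ δ Z ω} := by
  have : Nonempty S := ⟨s₁⟩
  set c : ℝ := 2 * Fintype.card S * Fintype.card A * H / δ with hc
  have hc0 : 0 < c := by positivity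
  let largeRatio (x : Fin H × S × A) : Set Ω := {ω | ∃ t, c ≤
    mixtureRatio (p x.1 x.2.1 x.2.2) (countNext (historyOf Z t ω) x.1 x.2.1 x.2.2)}
  let smallCount (x : Fin H × S × A) : Set Ω := {ω | ∃ t, Real.log c ≤
    pseudoCount alg p s₁ x.1 x.2.1 x.2.2 t (historyOf Z t ω) / 2 -
      count (historyOf Z t ω) x.1 x.2.1 x.2.2}
  have h_subset : ({ω | IsRegular alg p s₁ δ Z ω}ᶜ : Set Ω) ≤ᵐ[μ]
      ⋃ x, (largeRatio x ∪ smallCount x) := by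
    filter_upwards [hZ.ae_isRegular_or_exists hp δ] with ω hω h_not
    exact Set.mem_iUnion.2 (hω h_not)
  have h_irregular : μ.real {ω | IsRegular alg p s₁ δ Z ω}ᶜ ≤ δ := by
    calc _ ≤ μ.real (⋃ x, (largeRatio x ∪ smallCount x)) :=
          ENNReal.toReal_mono (measure_ne_top _ _) (measure_mono_ae h_subset)
      _ ≤ ∑ x, μ.real (largeRatio x ∪ smallCount x) := measureReal_iUnion_fintype_le _
      _ ≤ ∑ _ : Fin H × S × A, (1 / c + 1 / c) := by
          refine Finset.sum_le_sum fun x _ => (measureReal_union_le _ _).trans (add_le_add ?_ ?_)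
          · exact hZ.real_exists_le_mixtureRatio_le hp _ _ _ hc0
          · simpa only [Real.exp_log hc0] using
              hZ.real_exists_le_pseudoCount_sub_count_le hp x.1 x.2.1 x.2.2 (Real.log c)
      _ = δ := by
          simp only [Finset.sum_const, Finset.card_univ, Fintype.card_prod, Fintype.card_fin,
            nsmul_eq_mul, hc]
          push_cast
          field_simp
          ring
  have h_total := measureReal_union_le (μ := μ) {ω | IsRegular alg p s₁ δ Z ω}
    {ω | IsRegular alg p s₁ δ Z ω}ᶜ
  rw [Set.union_compl_self, probReal_univ] at h_total
  linarith

end Concentration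

section Deviation

variable {S : Type*} [Fintype S] {p q : S → ℝ}

lemma two_mul_sub_sqrt_mul_sqrt_le {x y : ℝ} (hx : 0 ≤ x) (hy : 0 ≤ y) (hxy : y = 0 → x = 0) :
    2 * (x - √x * √y) ≤ x * Real.log (x / y) := by
  rcases hx.eq_or_lt with rfl | hx
  · simp
  have hy : 0 < y := hy.lt_of_ne' (mt hxy hx.ne')
  have h_log : 1 - √(y / x) ≤ Real.log (x / y) / 2 := by
    have h_sqrt := Real.log_le_sub_one_of_pos (Real.sqrt_pos.2 (div_pos hy hx))
    rw [Real.log_sqrt (by positivity), ← inv_div x y, Real.log_inv] at h_sqrt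
    rw [← inv_div x y]
    linarith
  calc 2 * (x - √x * √y) = 2 * x * (1 - √(y / x)) := by
        rw [Real.sqrt_div' _ hx.le]
        field_simp
        linear_combination (-√y) * Real.mul_self_sqrt hx.le
    _ ≤ 2 * x * (Real.log (x / y) / 2) := by gcongr
    _ = x * Real.log (x / y) := by ring

lemma sum_sq_sqrt_sub_sqrt_le_of_kl_le (hp : p ∈ stdSimplex ℝ S) (hq : q ∈ stdSimplex ℝ S)
    {x : ℝ} (h_kl : kl p q ≤ x) : ∑ s, (√(p s) - √(q s)) ^ 2 ≤ x := by
  unfold kl at h_kl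
  split_ifs at h_kl with hac
  · calc ∑ s, (√(p s) - √(q s)) ^ 2 = ∑ s, (2 * (p s - √(p s) * √(q s)) + (q s - p s)) := by
          refine Finset.sum_congr rfl fun s _ => ?_
          rw [sub_sq, Real.sq_sqrt (hp.1 s), Real.sq_sqrt (hq.1 s)]
          ring
      _ = ∑ s, 2 * (p s - √(p s) * √(q s)) := by
          rw [Finset.sum_add_distrib, Finset.sum_sub_distrib, hp.2, hq.2, sub_self, add_zero]
      _ ≤ ∑ s, p s * Real.log (p s / q s) := Finset.sum_le_sum fun s _ =>
          two_mul_sub_sqrt_mul_sqrt_le (hp.1 s) (hq.1 s) (hac s)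
      _ ≤ x := EReal.coe_le_coe_iff.1 h_kl
  · exact absurd (top_le_iff.1 h_kl) (EReal.coe_ne_top x)

lemma sq_sum_abs_sub_le (hp : p ∈ stdSimplex ℝ S) (hq : q ∈ stdSimplex ℝ S) :
    (∑ s, |p s - q s|) ^ 2 ≤ 4 * ∑ s, (√(p s) - √(q s)) ^ 2 := by
  have h_factor (s : S) : |p s - q s| = (√(p s) + √(q s)) * |√(p s) - √(q s)| := by
    rw [← abs_of_nonneg (add_nonneg (Real.sqrt_nonneg (p s)) (Real.sqrt_nonneg (q s))),
      ← abs_mul, ← sq_sub_sq, Real.sq_sqrt (hp.1 s), Real.sq_sqrt (hq.1 s)]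
  have h_plus : ∑ s, (√(p s) + √(q s)) ^ 2 ≤ 4 := by
    calc _ ≤ ∑ s, 2 * (p s + q s) := Finset.sum_le_sum fun s _ => by
          simpa only [Real.sq_sqrt (hp.1 s), Real.sq_sqrt (hq.1 s)] using
            add_sq_le (a := √(p s)) (b := √(q s))
      _ = 4 := by
          rw [← Finset.mul_sum, Finset.sum_add_distrib, hp.2, hq.2]
          norm_num
  simp_rw [h_factor]
  calc _ ≤ (∑ s, (√(p s) + √(q s)) ^ 2) * ∑ s, |√(p s) - √(q s)| ^ 2 :=
        Finset.sum_mul_sq_le_sq_mul_sq _ _ _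
    _ ≤ 4 * ∑ s, (√(p s) - √(q s)) ^ 2 := by
        simp_rw [sq_abs]
        gcongr

lemma sum_abs_sub_le_of_kl_le (hp : p ∈ stdSimplex ℝ S) (hq : q ∈ stdSimplex ℝ S) {x : ℝ}
    (h_kl : kl p q ≤ x) : ∑ s, |p s - q s| ≤ 2 * √x := by
  have h_sq : (∑ s, |p s - q s|) ^ 2 ≤ 2 ^ 2 * x := by
    linarith [sq_sum_abs_sub_le hp hq, sum_sq_sqrt_sub_sqrt_le_of_kl_le hp hq h_kl]
  calc _ ≤ √(2 ^ 2 * x) := Real.le_sqrt_of_sq_le h_sq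
    _ = 2 * √x := by rw [Real.sqrt_mul (by norm_num), Real.sqrt_sq zero_le_two]

lemma sum_mul_mem_Icc (hq : q ∈ stdSimplex ℝ S) {W : S → ℝ} {m M : ℝ}
    (hW : ∀ s, W s ∈ Set.Icc m M) : ∑ s, q s * W s ∈ Set.Icc m M :=
  (convex_Icc m M).sum_mem (fun s _ => hq.1 s) hq.2 fun s _ => hW s

lemma abs_sum_mul_sub_sum_mul_le (hp : p ∈ stdSimplex ℝ S) (hq : q ∈ stdSimplex ℝ S)
    {W : S → ℝ} {M : ℝ} (hW : ∀ s, W s ∈ Set.Icc 0 M) :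
    |∑ s, p s * W s - ∑ s, q s * W s| ≤ M / 2 * ∑ s, |p s - q s| := by
  have h_center : ∑ s, p s * W s - ∑ s, q s * W s = ∑ s, (p s - q s) * (W s - M / 2) := by
    simp_rw [sub_mul, mul_sub, Finset.sum_sub_distrib, ← Finset.sum_mul]
    rw [hp.2, hq.2]
    ring
  rw [h_center, Finset.mul_sum]
  refine (Finset.abs_sum_le_sum_abs _ _).trans (Finset.sum_le_sum fun s _ => ?_)
  rw [abs_mul, mul_comm]
  gcongr
  exact abs_le.2 ⟨by linarith [(hW s).1], by linarith [(hW s).2]⟩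

end Deviation

section Bounds

lemma sSup_mem_Icc_zero {X : Set ℝ} {M : ℝ} (hM : 0 ≤ M) (hX : X ⊆ Set.Icc 0 M) :
    sSup X ∈ Set.Icc 0 M :=
  ⟨Real.sSup_nonneg fun _ hx => (hX hx).1, Real.sSup_le (fun _ hx => (hX hx).2) hM⟩

lemma sInf_mem_Icc_zero {X : Set ℝ} {M : ℝ} (hM : 0 ≤ M) (hX : X ⊆ Set.Icc 0 M) :
    sInf X ∈ Set.Icc 0 M := by
  refine ⟨Real.sInf_nonneg fun _ hx => (hX hx).1, ?_⟩
  rcases X.eq_empty_or_nonempty with rfl | ⟨x, hx⟩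
  · rwa [Real.sInf_empty]
  · exact (csInf_le ⟨0, fun y hy => (hX hy).1⟩ hx).trans (hX hx).2

lemma sigma_succ (γ : ℝ) (n : ℕ) : sigma γ (n + 1) = 1 + γ * sigma γ n := by
  simp only [sigma, Finset.sum_range_succ', Finset.mul_sum, pow_succ', pow_zero, add_comm]

lemma sigma_mono {γ : ℝ} (hγ : 0 ≤ γ) : Monotone (sigma γ) := fun _ _ hmn =>
  Finset.sum_le_sum_of_subset_of_nonneg (Finset.range_subset_range.2 hmn)
    fun i _ _ => pow_nonneg hγ i

lemma sigma_nonneg {γ : ℝ} (hγ : 0 ≤ γ) (n : ℕ) : 0 ≤ sigma γ n :=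
  Finset.sum_nonneg fun i _ => pow_nonneg hγ i

variable {S A : Type*} {H t : ℕ} {γ δ : ℝ}

lemma mem_Icc_sigma_of_iSup_backup (hγ : 0 ≤ γ)
    {r : Fin H → S → A → ℝ} (hr : ∀ h s a, r h s a ∈ Set.Icc (0 : ℝ) 1)
    {V : Fin (H + 1) → S → ℝ} {b : Fin H → S → A → ℝ} (hlast : ∀ s, V (Fin.last H) s = 0)
    (hV : ∀ h s, V h.castSucc s = ⨆ a, (r h s a + γ * b h s a))
    (hb : ∀ h s a M, (∀ s', V h.succ s' ∈ Set.Icc 0 M) → b h s a ∈ Set.Icc 0 M)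
    (h : Fin (H + 1)) (s : S) : V h s ∈ Set.Icc 0 (sigma γ (H - h)) := by
  induction h using Fin.reverseInduction generalizing s with
  | last => simp [hlast, sigma]
  | cast h ih =>
    have h_sub : H - (h.castSucc : ℕ) = H - (h.succ : ℕ) + 1 := by
      simp only [Fin.val_castSucc, Fin.val_succ]
      omega
    have h_backup (a : A) :
        r h s a + γ * b h s a ∈ Set.Icc 0 (sigma γ (H - (h.castSucc : ℕ))) := by
      have hba := hb h s a _ ih
      rw [h_sub, sigma_succ]
      exact ⟨add_nonneg (hr h s a).1 (mul_nonneg hγ hba.1),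
        add_le_add (hr h s a).2 (mul_le_mul_of_nonneg_left hba.2 hγ)⟩
    rw [hV]
    exact ⟨Real.iSup_nonneg fun a => (h_backup a).1,
      Real.iSup_le (fun a => (h_backup a).2) (sigma_nonneg hγ _)⟩

variable [DecidableEq S] [DecidableEq A] [Fintype S]

lemma empirical_mem_stdSimplex [Nonempty S] (D : History S A H t) (h : Fin H) (s : S) (a : A) :
    empirical D h s a ∈ stdSimplex ℝ S := by
  refine ⟨fun s' => ?_, ?_⟩ <;> unfold empirical <;> split_ifs with h0
  · positivity
  · positivity
  · simp
  · rw [← Finset.sum_div, ← Nat.cast_sum, sum_countNext, div_self (by exact_mod_cast h0)]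

variable [Fintype A]

/-- The square root of the confidence radius, truncated at `1`: up to a constant, a bound on the `ℓ¹`
diameter of the confidence region. Unvisited pairs have infinite radius and get `1`. -/
def width (δ : ℝ) (D : History S A H t) (h : Fin H) (s : S) (a : A) : ℝ :=
  if count D h s a = 0 then 1
  else min 1 √(threshold (Fintype.card S) (Fintype.card A) H δ (count D h s a) / count D h s a)

lemma width_nonneg (δ : ℝ) (D : History S A H t) (h : Fin H) (s : S) (a : A) :
    0 ≤ width δ D h s a := by
  unfold width
  split_ifs <;> positivity

lemma width_le_one (δ : ℝ) (D : History S A H t) (h : Fin H) (s : S) (a : A) :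
    width δ D h s a ≤ 1 := by
  unfold width
  split_ifs
  · exact le_rfl
  · exact min_le_left _ _

section ConfRegion

variable {D : History S A H t} {h : Fin H} {s : S} {a : A} {p q : S → ℝ} {W : S → ℝ} {M : ℝ}

lemma sum_abs_empirical_sub_le (hq : q ∈ confRegion δ D h s a) (h0 : count D h s a ≠ 0) :
    ∑ s', |empirical D h s a s' - q s'| ≤
      2 * √(threshold (Fintype.card S) (Fintype.card A) H δ (count D h s a) / count D h s a) := by
  have : Nonempty S := ⟨s⟩
  have h_kl := hq.2
  rw [radius, if_neg h0] at h_kl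
  exact sum_abs_sub_le_of_kl_le (empirical_mem_stdSimplex D h s a) hq.1 h_kl

lemma abs_sum_mul_sub_le_width (hp : p ∈ confRegion δ D h s a) (hq : q ∈ confRegion δ D h s a)
    (hW : ∀ s, W s ∈ Set.Icc 0 M) :
    |∑ s, p s * W s - ∑ s, q s * W s| ≤ 2 * M * width δ D h s a := by
  have hM : 0 ≤ M := (hW s).1.trans (hW s).2
  have h_trivial : |∑ s, p s * W s - ∑ s, q s * W s| ≤ 2 * M * 1 := by
    have hpW := sum_mul_mem_Icc hp.1 hW
    have hqW := sum_mul_mem_Icc hq.1 hW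
    exact abs_le.2 ⟨by linarith [hpW.1, hqW.2], by linarith [hpW.2, hqW.1]⟩
  unfold width
  split_ifs with h0
  · exact h_trivial
  rw [mul_min_of_nonneg _ _ (by positivity)]
  refine le_min h_trivial ?_
  have h_triangle : ∑ s', |p s' - q s'| ≤ ∑ s', |empirical D h s a s' - p s'| +
      ∑ s', |empirical D h s a s' - q s'| := by
    rw [← Finset.sum_add_distrib]
    exact Finset.sum_le_sum fun s' _ => abs_sub_comm (p s') _ ▸ abs_sub_le _ _ _
  calc _ ≤ M / 2 * ∑ s', |p s' - q s'| := abs_sum_mul_sub_sum_mul_le hp.1 hq.1 hW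
    _ ≤ M / 2 * (2 * √_ + 2 * √_) := by
        gcongr
        exact h_triangle.trans
          (add_le_add (sum_abs_empirical_sub_le hp h0) (sum_abs_empirical_sub_le hq h0))
    _ = _ := by ring

lemma image_confRegion_subset (hW : ∀ s, W s ∈ Set.Icc 0 M) :
    (fun q : S → ℝ => ∑ s', q s' * W s') '' confRegion δ D h s a ⊆ Set.Icc 0 M := by
  rintro _ ⟨q, hq, rfl⟩
  exact sum_mul_mem_Icc hq.1 hW

lemma sSup_image_confRegion_le (hp : p ∈ confRegion δ D h s a) (hW : ∀ s, W s ∈ Set.Icc 0 M) :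
    sSup ((fun q : S → ℝ => ∑ s', q s' * W s') '' confRegion δ D h s a) ≤
      ∑ s', p s' * W s' + 2 * M * width δ D h s a := by
  refine csSup_le ⟨_, p, hp, rfl⟩ ?_
  rintro _ ⟨q, hq, rfl⟩
  exact sub_le_iff_le_add'.1 (le_of_abs_le (abs_sum_mul_sub_le_width hq hp hW))

lemma le_sInf_image_confRegion (hp : p ∈ confRegion δ D h s a) (hW : ∀ s, W s ∈ Set.Icc 0 M) :
    ∑ s', p s' * W s' - 2 * M * width δ D h s a ≤
      sInf ((fun q : S → ℝ => ∑ s', q s' * W s') '' confRegion δ D h s a) := by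
  refine le_csInf ⟨_, p, hp, rfl⟩ ?_
  rintro _ ⟨q, hq, rfl⟩
  exact sub_le_comm.1 (le_of_abs_le (abs_sum_mul_sub_le_width hp hq hW))

end ConfRegion

section BackwardInduction

variable {r : Fin H → S → A → ℝ} {p : Fin H → S → A → S → ℝ} {D : History S A H t}

lemma upperV_last (γ δ : ℝ) (r : Fin H → S → A → ℝ) (D : History S A H t) (s : S) :
    upperV γ δ r D (Fin.last H) s = 0 := by
  simp [upperV]

lemma lowerV_last (γ δ : ℝ) (r : Fin H → S → A → ℝ) (D : History S A H t) (s : S) :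
    lowerV γ δ r D (Fin.last H) s = 0 := by
  simp [lowerV]

lemma upperV_castSucc (γ δ : ℝ) (r : Fin H → S → A → ℝ) (D : History S A H t) (h : Fin H)
    (s : S) : upperV γ δ r D h.castSucc s = ⨆ a, upperQ γ δ r D h s a := by
  simp [upperV, upperQ]

lemma lowerV_castSucc (γ δ : ℝ) (r : Fin H → S → A → ℝ) (D : History S A H t) (h : Fin H)
    (s : S) : lowerV γ δ r D h.castSucc s = ⨆ a, lowerQ γ δ r D h s a := by
  simp [lowerV, lowerQ]

lemma upperQ_le_upperV (γ δ : ℝ) (r : Fin H → S → A → ℝ) (D : History S A H t) (h : Fin H)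
    (s : S) (a : A) : upperQ γ δ r D h s a ≤ upperV γ δ r D h.castSucc s := by
  rw [upperV_castSucc]
  exact le_ciSup (Set.finite_range _).bddAbove a

lemma lowerQ_le_lowerV (γ δ : ℝ) (r : Fin H → S → A → ℝ) (D : History S A H t) (h : Fin H)
    (s : S) (a : A) : lowerQ γ δ r D h s a ≤ lowerV γ δ r D h.castSucc s := by
  rw [lowerV_castSucc]
  exact le_ciSup (Set.finite_range _).bddAbove a

lemma upperV_le_of_isGreedy {π : Policy S A H} (hπ : IsGreedy (upperQ γ δ r D) π) (h : Fin H)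
    (s : S) : upperV γ δ r D h.castSucc s ≤ upperQ γ δ r D h s (π h s) := by
  have : Nonempty A := ⟨π h s⟩
  rw [upperV_castSucc]
  exact ciSup_le fun a => hπ h s a

lemma lowerV_le_of_isGreedy {π : Policy S A H} (hπ : IsGreedy (lowerQ γ δ r D) π) (h : Fin H)
    (s : S) : lowerV γ δ r D h.castSucc s ≤ lowerQ γ δ r D h s (π h s) := by
  have : Nonempty A := ⟨π h s⟩
  rw [lowerV_castSucc]
  exact ciSup_le fun a => hπ h s a

lemma upperV_mem_Icc (hγ : 0 ≤ γ) (hr : ∀ h s a, r h s a ∈ Set.Icc (0 : ℝ) 1)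
    (h : Fin (H + 1)) (s : S) : upperV γ δ r D h s ∈ Set.Icc 0 (sigma γ (H - h)) :=
  mem_Icc_sigma_of_iSup_backup hγ hr (upperV_last γ δ r D) (upperV_castSucc γ δ r D)
    (fun _ s _ _ hV =>
      sSup_mem_Icc_zero ((hV s).1.trans (hV s).2) (image_confRegion_subset hV)) h s

lemma lowerV_mem_Icc (hγ : 0 ≤ γ) (hr : ∀ h s a, r h s a ∈ Set.Icc (0 : ℝ) 1)
    (h : Fin (H + 1)) (s : S) : lowerV γ δ r D h s ∈ Set.Icc 0 (sigma γ (H - h)) :=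
  mem_Icc_sigma_of_iSup_backup hγ hr (lowerV_last γ δ r D) (lowerV_castSucc γ δ r D)
    (fun _ s _ _ hV =>
      sInf_mem_Icc_zero ((hV s).1.trans (hV s).2) (image_confRegion_subset hV)) h s

section Optimism

variable (hγ : 0 ≤ γ) (hr : ∀ h s a, r h s a ∈ Set.Icc (0 : ℝ) 1)
  (hpD : ∀ h s a, p h s a ∈ confRegion δ D h s a)
include hγ hr hpD

lemma bellman_le_upperQ (h : Fin H) (s : S) (a : A) :
    r h s a + γ * ∑ s', p h s a s' * upperV γ δ r D h.succ s' ≤ upperQ γ δ r D h s a := by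
  have h_image := image_confRegion_subset (δ := δ) (D := D) (h := h) (s := s) (a := a)
    (upperV_mem_Icc (δ := δ) (D := D) hγ hr h.succ)
  unfold upperQ upperBackup
  gcongr
  exact le_csSup ⟨_, fun x hx => (h_image hx).2⟩ ⟨_, hpD h s a, rfl⟩

lemma lowerQ_le_bellman (h : Fin H) (s : S) (a : A) :
    lowerQ γ δ r D h s a ≤ r h s a + γ * ∑ s', p h s a s' * lowerV γ δ r D h.succ s' := by
  have h_image := image_confRegion_subset (δ := δ) (D := D) (h := h) (s := s) (a := a)
    (lowerV_mem_Icc (δ := δ) (D := D) hγ hr h.succ)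
  unfold lowerQ lowerBackup
  gcongr
  exact csInf_le ⟨_, fun x hx => (h_image hx).1⟩ ⟨_, hpD h s a, rfl⟩

lemma optValue_le_upperV (s₁ : S) : optValue γ r p s₁ ≤ upperV γ δ r D 0 s₁ :=
  Real.iSup_le (fun π => value_le_of_bellman hγ (fun h s a => (hpD h s a).1) π _
    (fun s => (upperV_last γ δ r D s).ge)
    (fun h s => (bellman_le_upperQ hγ hr hpD h s _).trans (upperQ_le_upperV _ _ _ _ _ _ _)) s₁)
    (upperV_mem_Icc hγ hr 0 s₁).1

lemma lowerV_le_value {π : Policy S A H} (hπ : IsGreedy (lowerQ γ δ r D) π) (s₁ : S) :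
    lowerV γ δ r D 0 s₁ ≤ value γ r p π s₁ :=
  le_value_of_bellman hγ (fun h s a => (hpD h s a).1) π _ (fun s => (lowerV_last γ δ r D s).le)
    (fun h s => (lowerV_le_of_isGreedy hπ h s).trans (lowerQ_le_bellman hγ hr hpD h s _)) s₁

lemma upperQ_sub_lowerQ_le (h : Fin H) (s : S) (a : A) :
    upperQ γ δ r D h s a - lowerQ γ δ r D h s a ≤ 4 * sigma γ H * width δ D h s a +
      γ * ∑ s', p h s a s' * (upperV γ δ r D h.succ s' - lowerV γ δ r D h.succ s') := by
  set M := sigma γ (H - (h.succ : ℕ))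
  have h_sup := mul_le_mul_of_nonneg_left
    (sSup_image_confRegion_le (hpD h s a) (upperV_mem_Icc (δ := δ) (D := D) hγ hr h.succ)) hγ
  have h_inf := mul_le_mul_of_nonneg_left
    (le_sInf_image_confRegion (hpD h s a) (lowerV_mem_Icc (δ := δ) (D := D) hγ hr h.succ)) hγ
  have h_sigma : γ * M ≤ sigma γ H := by
    have h_mono : sigma γ (H - (h.succ : ℕ) + 1) ≤ sigma γ H :=
      sigma_mono hγ (by rw [Fin.val_succ]; omega)
    rw [sigma_succ] at h_mono
    linarith
  have h_width := mul_le_mul_of_nonneg_right h_sigma (width_nonneg δ D h s a)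
  unfold upperQ upperBackup lowerQ lowerBackup
  simp_rw [mul_sub, Finset.sum_sub_distrib]
  linarith

lemma upperV_sub_lowerV_le_value {π : Policy S A H} (hπ : IsGreedy (upperQ γ δ r D) π) (s₁ : S) :
    upperV γ δ r D 0 s₁ - lowerV γ δ r D 0 s₁ ≤
      value γ (fun h s a => 4 * sigma γ H * width δ D h s a) p π s₁ := by
  refine le_value_of_bellman hγ (fun h s a => (hpD h s a).1) π
    (fun h s => upperV γ δ r D h s - lowerV γ δ r D h s) (fun s => ?_) (fun h s => ?_) s₁
  · simp [upperV_last, lowerV_last]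
  · exact (sub_le_sub (upperV_le_of_isGreedy hπ h s) (lowerQ_le_lowerV _ _ _ _ _ _ _)).trans
      (upperQ_sub_lowerQ_le hγ hr hpD h s (π h s))

end Optimism

end BackwardInduction

end Bounds

section Threshold

lemma sqrt_sub_sqrt_mul_sqrt_add_sqrt {x y : ℝ} (hx : 0 ≤ x) (hy : 0 ≤ y) :
    (√x - √y) * (√x + √y) = x - y := by
  rw [mul_comm, ← sq_sub_sq, Real.sq_sqrt hx, Real.sq_sqrt hy]

lemma div_sqrt_max_one_le {x y : ℝ} (hx : 0 ≤ x) (hy : y ∈ Set.Icc (0 : ℝ) 1) :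
    y / √(max 1 x) ≤ (1 + √2) * (√(x + y) - √x) := by
  obtain ⟨hy0, hy1⟩ := hy
  have h1_le : 1 ≤ max 1 x := le_max_left _ _
  have hx_le : x ≤ max 1 x := le_max_right _ _
  have h_mono : √x ≤ √(x + y) := Real.sqrt_le_sqrt (le_add_of_nonneg_right hy0)
  have h_add : √(x + y) ≤ √2 * √(max 1 x) := by
    rw [← Real.sqrt_mul zero_le_two]
    exact Real.sqrt_le_sqrt (by linarith)
  rw [div_le_iff₀ (by positivity)]
  calc y = (√(x + y) - √x) * (√(x + y) + √x) := by
        rw [sqrt_sub_sqrt_mul_sqrt_add_sqrt (add_nonneg hx hy0) hx, add_sub_cancel_left]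
    _ ≤ (√(x + y) - √x) * (√2 * √(max 1 x) + √(max 1 x)) :=
        mul_le_mul_of_nonneg_left (add_le_add h_add (Real.sqrt_le_sqrt hx_le))
          (sub_nonneg.2 h_mono)
    _ = (1 + √2) * (√(x + y) - √x) * √(max 1 x) := by ring

lemma sum_div_sqrt_max_one_le {x : ℕ → ℝ} (hx : ∀ i, x i ∈ Set.Icc (0 : ℝ) 1) (T : ℕ) :
    ∑ t ∈ Finset.range T, x t / √(max 1 (∑ i ∈ Finset.range t, x i)) ≤
      (1 + √2) * √(∑ i ∈ Finset.range T, x i) := by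
  induction T with
  | zero => simp
  | succ T ih =>
    rw [Finset.sum_range_succ, Finset.sum_range_succ]
    have h_nonneg : 0 ≤ ∑ i ∈ Finset.range T, x i := Finset.sum_nonneg fun i _ => (hx i).1
    linarith [div_sqrt_max_one_le h_nonneg (hx T)]

variable {nS nA H : ℕ} {δ : ℝ}

lemma threshold_mono (hS : 1 ≤ nS) {x y : ℝ} (hx : 0 ≤ x) (hxy : x ≤ y) :
    threshold nS nA H δ x ≤ threshold nS nA H δ y := by
  have hm : (0 : ℝ) ≤ (nS : ℝ) - 1 := sub_nonneg.2 (Nat.one_le_cast.2 hS)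
  unfold threshold
  gcongr

lemma log_le_threshold (hS : 1 ≤ nS) {x : ℝ} (hx : 0 ≤ x) :
    Real.log (2 * nS * nA * H / δ) ≤ threshold nS nA H δ x := by
  have hm : (0 : ℝ) ≤ (nS : ℝ) - 1 := sub_nonneg.2 (Nat.one_le_cast.2 hS)
  unfold threshold
  refine le_add_of_nonneg_right (mul_nonneg hm (Real.log_nonneg ?_))
  exact one_le_mul_of_one_le_of_one_le (Real.one_le_exp zero_le_one)
    (le_add_of_nonneg_right (div_nonneg hx hm))

lemma one_fourth_le_log (hS : 1 ≤ nS) (hA : 1 ≤ nA) (hH : 1 ≤ H) (hδ : 0 < δ) (hδ1 : δ ≤ 1) :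
    1 / 4 ≤ Real.log (2 * nS * nA * H / δ) := by
  have h_prod : (1 : ℝ) ≤ (nS * nA * H : ℕ) :=
    Nat.one_le_cast.2 (Nat.mul_pos (Nat.mul_pos hS hA) hH)
  push_cast at h_prod
  have h_two : (2 : ℝ) ≤ 2 * nS * nA * H / δ := by
    rw [le_div_iff₀ hδ]
    linarith
  calc (1 : ℝ) / 4 ≤ Real.log 2 := by linarith [Real.log_two_gt_d9]
    _ ≤ _ := Real.log_le_log two_pos h_two

lemma width_le {S A : Type*} [Fintype S] [Fintype A] [DecidableEq S] [DecidableEq A]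
    (hL : 1 / 4 ≤ Real.log (2 * Fintype.card S * Fintype.card A * H / δ)) {t T : ℕ} (ht : t ≤ T)
    (D : History S A H t) (h : Fin H) (s : S) (a : A) {N : ℝ}
    (hN : N / 2 - Real.log (2 * Fintype.card S * Fintype.card A * H / δ) ≤ count D h s a) :
    width δ D h s a ≤
      2 * √(threshold (Fintype.card S) (Fintype.card A) H δ T) / √(max 1 N) := by
  have hS : 1 ≤ Fintype.card S := Fintype.card_pos_iff.2 ⟨s⟩
  have hβ := log_le_threshold (nS := Fintype.card S) (nA := Fintype.card A) (H := H) (δ := δ) hS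
    (Nat.cast_nonneg T)
  set L := Real.log (2 * Fintype.card S * Fintype.card A * H / δ)
  set β := threshold (Fintype.card S) (Fintype.card A) H δ T
  have hM : 0 < max 1 N := lt_max_of_lt_left one_pos
  have h_sqrt : 2 * √β / √(max 1 N) = √(4 * β / max 1 N) := by
    rw [Real.sqrt_div' _ hM.le, Real.sqrt_mul zero_le_four,
      show (4 : ℝ) = 2 ^ 2 by norm_num, Real.sqrt_sq zero_le_two]
  rw [h_sqrt]
  rcases le_or_gt N (4 * L) with hNL | hNL
  · refine (width_le_one δ D h s a).trans (Real.one_le_sqrt.2 ((one_le_div hM).2 ?_))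
    exact max_le (by linarith) (by linarith)
  · have hn : (0 : ℝ) < count D h s a := by linarith
    have h_mono : threshold (Fintype.card S) (Fintype.card A) H δ (count D h s a) ≤ β :=
      threshold_mono hS hn.le (Nat.cast_le.2 ((count_le D h s a).trans ht))
    rw [width, if_neg (Nat.cast_ne_zero.1 hn.ne'), max_eq_right (by linarith)]
    refine (min_le_right _ _).trans (Real.sqrt_le_sqrt ?_)
    calc _ ≤ β / count D h s a := by gcongr
      _ ≤ β / (N / 4) := div_le_div_of_nonneg_left (by linarith) (by linarith) (by linarith)
      _ = 4 * β / N := by rw [div_div_eq_mul_div, mul_comm]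

end Threshold

section LogInversion

lemma log_le_sqrt {x : ℝ} (hx : 0 < x) : Real.log x ≤ √x := by
  have h_exp : Real.log (√x / Real.exp 1) ≤ √x / Real.exp 1 - 1 :=
    Real.log_le_sub_one_of_pos (by positivity)
  rw [Real.log_div (Real.sqrt_pos.2 hx).ne' (Real.exp_ne_zero 1), Real.log_exp,
    Real.log_sqrt hx.le] at h_exp
  have h_half : √x / Real.exp 1 ≤ √x / 2 := by
    gcongr
    linarith [Real.add_one_le_exp (1 : ℝ)]
  linarith

lemma mul_sqrt_div {m x : ℝ} (hm : 0 ≤ m) : m * √(x / m) = √m * √x := by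
  rw [Real.sqrt_div' _ hm, mul_div_left_comm, Real.div_sqrt, mul_comm]

variable {K L m T : ℝ}

lemma sqrt_le_of_le_mul_add_sqrt {c : ℝ} (hK : 1 ≤ K) (hL : 0 ≤ L) (hm : 1 ≤ m) (hT : 0 ≤ T)
    (hc : 1 ≤ c) (h : T ≤ K * (L + c * √m * √(m + T))) :
    √(m + T) ≤ K * (L + (m * c + c * √m)) := by
  have hU : 1 ≤ √(m + T) := Real.one_le_sqrt.2 (by linarith)
  have h_sq := Real.mul_self_sqrt (show 0 ≤ m + T by linarith)
  set U := √(m + T)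
  have hmU : m ≤ K * (m * c) * U := by
    have h_one : 1 ≤ K * c * U :=
      one_le_mul_of_one_le_of_one_le (one_le_mul_of_one_le_of_one_le hK hc) hU
    nlinarith
  have hLU : K * L ≤ K * L * U := le_mul_of_one_le_right (by positivity) hU
  refine le_of_mul_le_mul_right (a := U) ?_ (by linarith)
  calc U * U ≤ m + K * (L + c * √m * U) := by linarith
    _ ≤ K * (m * c) * U + K * L * U + K * (c * √m * U) := by linarith
    _ = K * (L + (m * c + c * √m)) * U := by ring

lemma one_add_div_le_of_le_mul_log (hK : 1 ≤ K) (hL : 0 ≤ L) (hm : 1 ≤ m) (hT : 0 ≤ T)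
    (h : T ≤ K * (L + m * Real.log (Real.exp 1 * (1 + T / m)))) :
    1 + T / m ≤ (K * (L + m * (√(Real.exp 1) + √(Real.exp 1 / m)))) ^ 2 := by
  have hm0 : 0 < m := by linarith
  have h_log : m * Real.log (Real.exp 1 * (1 + T / m)) ≤ √(Real.exp 1) * √m * √(m + T) := by
    calc _ ≤ m * √(Real.exp 1 * (1 + T / m)) := by
          gcongr
          exact log_le_sqrt (by positivity)
      _ = m * √(Real.exp 1 * (m + T) / m) := by
          congr 2
          field_simp
      _ = √(Real.exp 1) * √m * √(m + T) := by
          rw [mul_sqrt_div hm0.le, Real.sqrt_mul (Real.exp_pos 1).le]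
          ring
  have h_sqrt := sqrt_le_of_le_mul_add_sqrt hK hL hm hT
    (Real.one_le_sqrt.2 (Real.one_le_exp zero_le_one)) (h.trans (by gcongr))
  calc 1 + T / m ≤ m + T := add_le_add hm (div_le_self hT hm)
    _ = √(m + T) ^ 2 := (Real.sq_sqrt (by linarith)).symm
    _ ≤ _ := by
      rw [mul_add m, mul_sqrt_div hm0.le, mul_comm √m]
      gcongr

lemma le_mul_of_le_mul_log (hK : 1 ≤ K) (hL : 0 ≤ L) (hm : m = 0 ∨ 1 ≤ m) (hT : 0 ≤ T)
    (h : T ≤ K * (L + m * Real.log (Real.exp 1 * (1 + T / m)))) :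
    T ≤ K * (L + 2 * m * Real.log (K * (L + m * (√(Real.exp 1) + √(Real.exp 1 / m)))) + m) := by
  rcases hm with rfl | hm
  · simpa using h
  have h_pos : 0 < 1 + T / m := by positivity
  have h_log := Real.log_le_log h_pos (one_add_div_le_of_le_mul_log hK hL hm hT h)
  rw [Real.log_pow, Nat.cast_two] at h_log
  calc T ≤ K * (L + m * (1 + Real.log (1 + T / m))) := by
        rwa [Real.log_mul (Real.exp_ne_zero 1) h_pos.ne', Real.log_exp] at h
    _ ≤ K * (L + m * (1 + 2 * Real.log (K * (L + m * (√(Real.exp 1) + √(Real.exp 1 / m)))))) := by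
        gcongr
    _ = _ := by ring

end LogInversion

section Stopping

lemma sigma_eq_sum_fin (γ : ℝ) (H : ℕ) : sigma γ H = ∑ h : Fin H, γ ^ (h : ℕ) :=
  (Fin.sum_univ_eq_sum_range (fun i => γ ^ i) H).symm

lemma one_le_constC_mul_div {nS nA H : ℕ} {γ ε : ℝ} (hS : 1 ≤ nS) (hA : 1 ≤ nA) (hH : 1 ≤ H)
    (hγ : 0 ≤ γ) (hε : 0 < ε) (hεσ : ε ≤ sigma γ H) :
    1 ≤ constC γ H * nS * nA / ε ^ 2 := by
  have hσ : 1 ≤ sigma γ H := by simpa [sigma] using sigma_mono hγ hH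
  have h_card : (1 : ℝ) ≤ (nS * nA : ℕ) := Nat.one_le_cast.2 (Nat.mul_pos hS hA)
  have h_const : (1 : ℝ) ≤ 64 * (1 + √2) ^ 2 :=
    one_le_mul_of_one_le_of_one_le (by norm_num)
      (one_le_pow₀ (le_add_of_nonneg_right (Real.sqrt_nonneg 2)))
  rw [one_le_div (by positivity)]
  calc ε ^ 2 ≤ sigma γ H ^ 2 := by gcongr
    _ ≤ sigma γ H ^ 4 := pow_le_pow_right₀ hσ (by norm_num)
    _ = 1 * sigma γ H ^ 4 * 1 := by ring
    _ ≤ 64 * (1 + √2) ^ 2 * sigma γ H ^ 4 * (nS * nA : ℕ) := by gcongr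
    _ = constC γ H * nS * nA := by
        rw [constC]
        push_cast
        ring

variable {S A : Type*} [Fintype S] [Fintype A] [DecidableEq S] [DecidableEq A] {H : ℕ}
  {γ ε δ : ℝ} {r : Fin H → S → A → ℝ} {s₁ : S} {alg : Algorithm S A H}
  {p : Fin H → S → A → S → ℝ} {Ω : Type*} {Z : ℕ → Ω → Episode S A H} {ω : Ω}

lemma sum_pseudoCount (hp : ∀ h s a, p h s a ∈ stdSimplex ℝ S) (T : ℕ) (h : Fin H) :
    ∑ x : S × A, pseudoCount alg p s₁ h x.1 x.2 T (historyOf Z T ω) = T := by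
  simp_rw [pseudoCount_historyOf]
  rw [Finset.sum_comm]
  simp [sum_occupancy hp]

lemma sum_sqrt_pseudoCount_le (hp : ∀ h s a, p h s a ∈ stdSimplex ℝ S) (T : ℕ) (h : Fin H) :
    ∑ x : S × A, √(pseudoCount alg p s₁ h x.1 x.2 T (historyOf Z T ω)) ≤
      √(Fintype.card S * Fintype.card A * T) := by
  have h_sq (x : S × A) : √(pseudoCount alg p s₁ h x.1 x.2 T (historyOf Z T ω)) ^ 2 =
      pseudoCount alg p s₁ h x.1 x.2 T (historyOf Z T ω) := by
    refine Real.sq_sqrt ?_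
    rw [pseudoCount_historyOf]
    exact Finset.sum_nonneg fun i _ => occupancy_nonneg hp _ _ _ _ _
  refine Real.le_sqrt_of_sq_le (sq_sum_le_card_mul_sum_sq.trans_eq ?_)
  simp [h_sq, sum_pseudoCount hp]

lemma IsBPIUCRL.le_sigma_of_not_halts (halg : IsBPIUCRL alg γ ε δ r s₁) (hγ : 0 ≤ γ)
    (hr : ∀ h s a, r h s a ∈ Set.Icc (0 : ℝ) 1) {t : ℕ} (ht : ¬ alg.halts t (historyOf Z t ω)) :
    ε ≤ sigma γ H := by
  rw [halg.halts_iff, not_le] at ht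
  have h_upper := (upperV_mem_Icc (δ := δ) (D := historyOf Z t ω) hγ hr 0 s₁).2
  rw [Fin.val_zero, Nat.sub_zero] at h_upper
  linarith [(lowerV_mem_Icc (δ := δ) (D := historyOf Z t ω) hγ hr 0 s₁).1]

namespace IsRegular

lemma mem_stdSimplex (hω : IsRegular alg p s₁ δ Z ω) (h : Fin H) (s : S) (a : A) :
    p h s a ∈ stdSimplex ℝ S :=
  (hω.mem_confRegion 0 h s a).1

lemma sum_occupancy_mul_width_le (hω : IsRegular alg p s₁ δ Z ω)
    (hL : 1 / 4 ≤ Real.log (2 * Fintype.card S * Fintype.card A * H / δ)) (T : ℕ) (h : Fin H)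
    (s : S) (a : A) :
    ∑ t ∈ Finset.range T, occupancy p (alg.policy t (historyOf Z t ω)) s₁ h s a *
        width δ (historyOf Z t ω) h s a ≤
      2 * (1 + √2) * √(threshold (Fintype.card S) (Fintype.card A) H δ T) *
        √(pseudoCount alg p s₁ h s a T (historyOf Z T ω)) := by
  let x (t : ℕ) : ℝ := occupancy p (alg.policy t (historyOf Z t ω)) s₁ h s a
  have hx (t : ℕ) : x t ∈ Set.Icc (0 : ℝ) 1 :=
    ⟨occupancy_nonneg hω.mem_stdSimplex _ _ _ _ _, occupancy_le_one hω.mem_stdSimplex _ _ _ _ _⟩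
  have h_count (t : ℕ) := hω.pseudoCount_sub_le_count t h s a
  simp only [pseudoCount_historyOf] at h_count ⊢
  set β := threshold (Fintype.card S) (Fintype.card A) H δ T
  calc _ ≤ ∑ t ∈ Finset.range T, x t * (2 * √β / √(max 1 (∑ i ∈ Finset.range t, x i))) :=
        Finset.sum_le_sum fun t ht => mul_le_mul_of_nonneg_left
          (width_le hL (Finset.mem_range.1 ht).le _ h s a (h_count t)) (hx t).1
    _ = 2 * √β * ∑ t ∈ Finset.range T, x t / √(max 1 (∑ i ∈ Finset.range t, x i)) := by
        simp_rw [Finset.mul_sum, mul_div_left_comm]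
    _ ≤ 2 * √β * ((1 + √2) * √(∑ i ∈ Finset.range T, x i)) := by
        gcongr
        exact sum_div_sqrt_max_one_le hx T
    _ = _ := by ring

lemma sum_value_width_le (hω : IsRegular alg p s₁ δ Z ω) (hγ : 0 ≤ γ)
    (hL : 1 / 4 ≤ Real.log (2 * Fintype.card S * Fintype.card A * H / δ)) (T : ℕ) :
    ∑ t ∈ Finset.range T,
        value γ (width δ (historyOf Z t ω)) p (alg.policy t (historyOf Z t ω)) s₁ ≤
      2 * (1 + √2) * sigma γ H * √(threshold (Fintype.card S) (Fintype.card A) H δ T) *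
        √(Fintype.card S * Fintype.card A * T) := by
  set β := threshold (Fintype.card S) (Fintype.card A) H δ T
  have h_step (h : Fin H) : ∑ x : S × A, ∑ t ∈ Finset.range T,
      occupancy p (alg.policy t (historyOf Z t ω)) s₁ h x.1 x.2 *
        width δ (historyOf Z t ω) h x.1 x.2 ≤
      2 * (1 + √2) * √β * √(Fintype.card S * Fintype.card A * T) := by
    refine (Finset.sum_le_sum fun x _ =>
      hω.sum_occupancy_mul_width_le hL T h x.1 x.2).trans ?_
    rw [← Finset.mul_sum]
    gcongr
    exact sum_sqrt_pseudoCount_le hω.mem_stdSimplex T h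
  simp_rw [value_eq_sum_occupancy]
  rw [Finset.sum_comm]
  simp_rw [← Finset.mul_sum, Finset.sum_comm (s := Finset.range T)]
  calc _ ≤ ∑ h : Fin H, γ ^ (h : ℕ) *
        (2 * (1 + √2) * √β * √(Fintype.card S * Fintype.card A * T)) :=
        Finset.sum_le_sum fun h _ => mul_le_mul_of_nonneg_left (h_step h) (pow_nonneg hγ _)
    _ = _ := by
        rw [← Finset.sum_mul, ← sigma_eq_sum_fin]
        ring

variable (hω : IsRegular alg p s₁ δ Z ω) (halg : IsBPIUCRL alg γ ε δ r s₁)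
  (hγ : 0 ≤ γ) (hr : ∀ h s a, r h s a ∈ Set.Icc (0 : ℝ) 1)
include hω halg hγ hr

lemma optValue_sub_value_le {t : ℕ} (ht : alg.halts t (historyOf Z t ω)) :
    optValue γ r p s₁ - value γ r p (alg.recommend t (historyOf Z t ω)) s₁ ≤ ε := by
  linarith [(halg.halts_iff t _).1 ht, optValue_le_upperV hγ hr (hω.mem_confRegion t) s₁,
    lowerV_le_value hγ hr (hω.mem_confRegion t) (halg.greedy_lower t _) s₁]

lemma mul_le_of_not_halts
    (hL : 1 / 4 ≤ Real.log (2 * Fintype.card S * Fintype.card A * H / δ)) {T : ℕ}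
    (hT : ∀ t < T, ¬ alg.halts t (historyOf Z t ω)) :
    T * ε ≤ 8 * (1 + √2) * sigma γ H ^ 2 *
      √(threshold (Fintype.card S) (Fintype.card A) H δ T) *
        √(Fintype.card S * Fintype.card A * T) := by
  have h_gap (t : ℕ) (ht : t ∈ Finset.range T) : ε ≤ 4 * sigma γ H *
      value γ (width δ (historyOf Z t ω)) p (alg.policy t (historyOf Z t ω)) s₁ := by
    have h_not := hT t (Finset.mem_range.1 ht)
    rw [halg.halts_iff, not_le] at h_not
    rw [← value_const_mul]
    exact h_not.le.trans (upperV_sub_lowerV_le_value hγ hr (hω.mem_confRegion t)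
      (halg.greedy_upper t _) s₁)
  have hσ := sigma_nonneg hγ H
  calc T * ε = ∑ _t ∈ Finset.range T, ε := by simp
    _ ≤ 4 * sigma γ H * ∑ t ∈ Finset.range T,
        value γ (width δ (historyOf Z t ω)) p (alg.policy t (historyOf Z t ω)) s₁ := by
        rw [Finset.mul_sum]
        exact Finset.sum_le_sum h_gap
    _ ≤ 4 * sigma γ H * (2 * (1 + √2) * sigma γ H * √_ * √_) := by
        gcongr
        exact hω.sum_value_width_le hγ hL T
    _ = _ := by ring

lemma le_mul_threshold_of_not_halts (hε : 0 < ε)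
    (hL : 1 / 4 ≤ Real.log (2 * Fintype.card S * Fintype.card A * H / δ)) {T : ℕ}
    (hT : ∀ t < T, ¬ alg.halts t (historyOf Z t ω)) :
    (T : ℝ) ≤ constC γ H * Fintype.card S * Fintype.card A / ε ^ 2 *
      threshold (Fintype.card S) (Fintype.card A) H δ T := by
  have h_mul := hω.mul_le_of_not_halts halg hγ hr hL hT
  have hβ : 0 ≤ threshold (Fintype.card S) (Fintype.card A) H δ T := by
    linarith [log_le_threshold (nA := Fintype.card A) (H := H) (δ := δ)
      (Fintype.card_pos_iff.2 ⟨s₁⟩) T.cast_nonneg]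
  set β := threshold (Fintype.card S) (Fintype.card A) H δ T
  rcases T.eq_zero_or_pos with rfl | hT0
  · rw [Nat.cast_zero, constC]
    positivity
  have h_sq : (T * ε) ^ 2 ≤ constC γ H * (Fintype.card S * Fintype.card A * T) * β := by
    refine (pow_le_pow_left₀ (by positivity) h_mul 2).trans_eq ?_
    rw [mul_pow, Real.sq_sqrt (by positivity), mul_pow, Real.sq_sqrt hβ, constC]
    ring
  rw [div_mul_eq_mul_div, le_div_iff₀ (by positivity)]
  refine le_of_mul_le_mul_left ?_ (Nat.cast_pos.2 hT0 : (0 : ℝ) < T)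
  linarith

variable (hH : 1 ≤ H) (hε : 0 < ε) (hδ : 0 < δ) (hδ1 : δ ≤ 1)
include hH hε hδ hδ1

lemma le_max_sampleBound_of_not_halts {T : ℕ} (hT : ∀ t < T, ¬ alg.halts t (historyOf Z t ω)) :
    (T : ℝ) ≤ max 0 (sampleBound (Fintype.card S) (Fintype.card A) H γ ε δ) := by
  rcases T.eq_zero_or_pos with rfl | hT0
  · simp
  have hS : 1 ≤ Fintype.card S := Fintype.card_pos_iff.2 ⟨s₁⟩
  have hA : 1 ≤ Fintype.card A :=
    Fintype.card_pos_iff.2 ⟨alg.policy 0 (historyOf Z 0 ω) ⟨0, hH⟩ s₁⟩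
  have hL := one_fourth_le_log hS hA hH hδ hδ1
  have hm : (Fintype.card S : ℝ) - 1 = 0 ∨ 1 ≤ (Fintype.card S : ℝ) - 1 := by
    rcases hS.eq_or_lt with h_one | h_two
    · simp [← h_one]
    · exact .inr (le_sub_iff_add_le.2 (by exact_mod_cast h_two))
  have hK := one_le_constC_mul_div hS hA hH hγ hε
    (halg.le_sigma_of_not_halts hγ hr (hT 0 hT0))
  exact le_max_of_le_right (le_mul_of_le_mul_log hK (by linarith) hm T.cast_nonneg
    (hω.le_mul_threshold_of_not_halts halg hγ hr hε hL hT))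

lemma exists_stoppingTime_eq :
    ∃ t : ℕ, stoppingTime alg Z ω = t ∧ alg.halts t (historyOf Z t ω) ∧
      (t : ℝ) ≤ max 0 (sampleBound (Fintype.card S) (Fintype.card A) H γ ε δ) := by
  classical
  have h_bound (T : ℕ) (hT : ∀ t < T, ¬ alg.halts t (historyOf Z t ω)) :=
    hω.le_max_sampleBound_of_not_halts halg hγ hr hH hε hδ hδ1 hT
  have h_halts : ∃ t, alg.halts t (historyOf Z t ω) := by
    by_contra! h_never
    obtain ⟨T, hT⟩ := exists_nat_gt (max 0 (sampleBound (Fintype.card S) (Fintype.card A) H γ ε δ))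
    exact hT.not_ge (h_bound T fun t _ => h_never t)
  refine ⟨Nat.find h_halts, le_antisymm (sInf_le ⟨_, Nat.find_spec h_halts, rfl⟩) (le_sInf ?_),
    Nat.find_spec h_halts, h_bound _ fun t ht => Nat.find_min h_halts ht⟩
  rintro _ ⟨t, ht, rfl⟩
  exact Nat.cast_le.2 (Nat.find_min' h_halts ht)

end IsRegular

end Stopping

end

end BPI

theorem theorem2_general {S A : Type*} [Fintype S] [Fintype A] [DecidableEq S] [DecidableEq A]
    {H : ℕ} (hH : 1 ≤ H)
    {γ ε δ : ℝ} (hγ : 0 ≤ γ) (hε : 0 < ε) (hδ : 0 < δ) (hδ1 : δ ≤ 1)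
    (r : Fin H → S → A → ℝ) (hr : ∀ h s a, r h s a ∈ Set.Icc (0 : ℝ) 1) (s₁ : S)
    (alg : BPI.Algorithm S A H) (halg : BPI.IsBPIUCRL alg γ ε δ r s₁)
    (p : Fin H → S → A → S → ℝ) (hp : ∀ h s a, p h s a ∈ stdSimplex ℝ S)
    {Ω : Type*} [MeasurableSpace Ω] (μ : MeasureTheory.Measure Ω)
    [MeasureTheory.IsProbabilityMeasure μ]
    (Z : ℕ → Ω → BPI.Episode S A H) (hZ : BPI.IsRun μ alg p s₁ Z) :
    1 - δ ≤ μ.real {ω | BPI.Succeeds alg γ ε r p s₁ Z ω} ∧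
      1 - δ ≤ μ.real {ω | ∃ t : ℕ, BPI.stoppingTime alg Z ω = t ∧
        (t : ℝ) ≤ max 0 (BPI.sampleBound (Fintype.card S) (Fintype.card A) H γ ε δ)} := by
  have : Nonempty A := ⟨alg.policy 0 Fin.elim0 ⟨0, hH⟩ s₁⟩
  have h_regular := hZ.one_sub_le_real_isRegular hp hδ hH
  refine ⟨h_regular.trans (MeasureTheory.measureReal_mono fun ω hω => ?_),
    h_regular.trans (MeasureTheory.measureReal_mono fun ω hω => ?_)⟩ <;>
  obtain ⟨t, h_time, h_halts, h_bound⟩ := hω.exists_stoppingTime_eq halg hγ hr hH hε hδ hδ1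
  · exact ⟨t, h_time, hω.optValue_sub_value_le halg hγ hr h_halts⟩
  · exact ⟨t, h_time, h_bound⟩

theorem theorem2 {S A : Type*} [Fintype S] [Fintype A] [DecidableEq S] [DecidableEq A]
    (hA : 2 ≤ Fintype.card A) {H : ℕ} (hH : 1 ≤ H)
    {γ ε δ : ℝ} (hγ : 0 < γ) (hγ1 : γ ≤ 1) (hε : 0 < ε) (hδ : 0 < δ) (hδ1 : δ < 1)
    (r : Fin H → S → A → ℝ) (hr : ∀ h s a, r h s a ∈ Set.Icc (0 : ℝ) 1) (s₁ : S)
    (alg : BPI.Algorithm S A H) (halg : BPI.IsBPIUCRL alg γ ε δ r s₁)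
    (p : Fin H → S → A → S → ℝ) (hp : ∀ h s a, p h s a ∈ stdSimplex ℝ S)
    {Ω : Type*} [MeasurableSpace Ω] (μ : MeasureTheory.Measure Ω)
    [MeasureTheory.IsProbabilityMeasure μ]
    (Z : ℕ → Ω → BPI.Episode S A H) (hZ : BPI.IsRun μ alg p s₁ Z) :
    1 - δ ≤ μ.real {ω | BPI.Succeeds alg γ ε r p s₁ Z ω} ∧
      1 - δ ≤ μ.real {ω | ∃ t : ℕ, BPI.stoppingTime alg Z ω = t ∧
        (t : ℝ) ≤ max 0 (BPI.sampleBound (Fintype.card S) (Fintype.card A) H γ ε δ)} :=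
  theorem2_general hH hγ.le hε hδ hδ1.le r hr s₁ alg halg p hp μ Z hZ
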